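/- Let $m\ge 2$ and let $f:(S^1)^m\to\mathbb R\cup\{-\infty\}$ be a kernel on the unit circle $S^1$ such that: (A1) $f$ is invariant under rotations, i.e. $f(U_1,\dots,U_m)=h(\beta_1,\dots,\beta_{m-1})$, where $\beta_j\in[0,2\pi)$ is the counterclockwise central angle from $U_1$ to $U_{j+1}$; (A2) $f$ is invariant under all permutations of its arguments; (A3) $h$ extends continuously to $h:[0,2\pi]^{m-1}\to\mathbb R\cup\{-\infty\}$; (A4) $h$ attains its maximal value $M$ on $[0,2\pi]^{m-1}$ at only finitely many points $V_1,\dots,V_k$, and all of them lie in $(0,2\pi)^{m-1}$; (A5) for some $\delta>0$ the function $h$ is three times continuously differentiable in the $\delta$-neighbourhood of each $V_i$; (A6) the Hessian matrix $G_i$ of $h$ at $V_i$ satisfies $\det G_i\ne0$ for each $i$. Let $U_1,U_2,\dots$ be independent and uniformly distributed points on $S^1$, and put $$H_n=\max_{1\le i_1<\dots<i_m\le n} f(U_{i_1},\dots,U_{i_m}),\qquad n\ge m.$$ Then for every $t>0$ $$\lim_{n\to\infty}\mathbb P\left\{n^{\frac{2m}{m-1}}(M-H_n)\le t\right\}=1-\exp\left(-\frac{t^{\frac{m-1}{2}}K}{m!}\right),\qquad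 K=\frac{1}{(2\pi)^{\frac{m-1}{2}}\,\Gamma\left(\frac{m+1}{2}\right)}\sum_{i=1}^k\frac{1}{\sqrt{\det(-G_i)}},$$ and the rate of convergence is $O\left(n^{-\frac1{m-1}}\right)$: for every $t>0$, $$\mathbb P\left\{n^{\frac{2m}{m-1}}(M-H_n)\le t\right\}-\left(1-\exp\left(-\frac{t^{\frac{m-1}{2}}K}{m!}\right)\right)=O\left(n^{-\frac1{m-1}}\right)\qquad(n\to\infty).$$ -/

import Mathlib

open Set Filter Topology MeasureTheory ProbabilityTheory Asymptotics

noncomputable section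

namespace UMax

/-- The closed cube `[0, 2π]^d` of central angles; `d = m - 1` for a kernel of degree `m`. -/
def angleCube (d : ℕ) : Set (Fin d → ℝ) :=
  {β | ∀ j, β j ∈ Icc (0 : ℝ) (2 * Real.pi)}

/-- The Hessian matrix `(∂²h / ∂xᵢ ∂xⱼ)(v)` of a function `h` that is real-valued near `v`. -/
def hessian {d : ℕ} (h : (Fin d → ℝ) → EReal) (v : Fin d → ℝ) : Matrix (Fin d) (Fin d) ℝ :=
  Matrix.of fun i j =>
    fderiv ℝ (fun x => fderiv ℝ (fun y => (h y).toReal) x (Pi.single j 1)) v (Pi.single i 1)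

/-- The conditions on a kernel `f` of degree `m = d + 1` on the unit circle. Here `h` is the
expression of `f` through the central angles (continuously extended to the closed cube; its values
off the closed cube play no role), `M` is the maximum of `h` and `V` is the set of points of maximum.
The values of `f` and `h` lie in `ℝ ∪ {-∞}`: the value `⊤` is excluded by `max_value`
since `M` is real. -/
structure KernelConditions {d : ℕ} (f : (Fin (d + 1) → Circle) → EReal)
    (h : (Fin d → ℝ) → EReal) (M : ℝ) (V : Finset (Fin d → ℝ)) : Prop where
  /-- `f` is a function of the central angles `βⱼ ∈ [0, 2π)`, counted counterclockwise from the
  first point `z` (so `f` is invariant under rotations). -/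
  rotation_invariant : ∀ (z : Circle) (β : Fin d → ℝ), (∀ j, β j ∈ Ico (0 : ℝ) (2 * Real.pi)) →
    f (Fin.cons z fun j => z * Circle.exp (β j)) = h β
  /-- `f` is symmetric. -/
  symmetric : ∀ (σ : Equiv.Perm (Fin (d + 1))) (u : Fin (d + 1) → Circle), f (u ∘ σ) = f u
  /-- `h` is continuous on the closed cube. -/
  continuousOn : ContinuousOn h (angleCube d)
  /-- `h` attains its maximal value `M` on the closed cube. -/
  max_value : IsGreatest (h '' angleCube d) (M : EReal)
  /-- `V` is the (finite) set of points of maximum. -/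
  max_points : ∀ β, β ∈ V ↔ β ∈ angleCube d ∧ h β = (M : EReal)
  /-- No point of maximum lies on the boundary of the cube. -/
  max_points_interior : ∀ v ∈ V, ∀ j, v j ∈ Ioo (0 : ℝ) (2 * Real.pi)
  /-- `h` is (finite and) three times continuously differentiable near the points of maximum. -/
  smooth : ∃ δ : ℝ, 0 < δ ∧ ∀ v ∈ V, Metric.ball v δ ⊆ angleCube d ∧
    (∀ x ∈ Metric.ball v δ, h x ≠ ⊥) ∧
    ContDiffOn ℝ 3 (fun x => (h x).toReal) (Metric.ball v δ)
  /-- The Hessian at each point of maximum is non-degenerate. -/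
  hessian_nondegenerate : ∀ v ∈ V, (hessian h v).det ≠ 0

instance : MeasurableSpace Circle := borel Circle

instance : BorelSpace Circle := ⟨rfl⟩

/-- The uniform distribution on the unit circle: the law of `exp (iθ)`, where `θ` has density
`1 / (2π)` on `[0, 2π)`. -/
def uniformCircle : Measure Circle :=
  Measure.map Circle.exp
    (ENNReal.ofReal (1 / (2 * Real.pi)) • volume.restrict (Ico (0 : ℝ) (2 * Real.pi)))

/-- The U-max statistic `H_n`, the maximum of `f (x_{i_1}, …, x_{i_m})` over
`i_1 < … < i_m` among the first `n` indices. The index set is finite, and for `n ≥ m` it is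
non-empty, so that the supremum is a maximum. -/
def uMax {m : ℕ} (f : (Fin m → Circle) → EReal) (n : ℕ) (x : ℕ → Circle) : EReal :=
  ⨆ J : Fin m ↪o Fin n, f fun i => x (J i)

/-- The constant `K` for uniformly distributed points, with `d = m - 1`. -/
def uniformConst {d : ℕ} (h : (Fin d → ℝ) → EReal) (V : Finset (Fin d → ℝ)) : ℝ :=
  1 / ((2 * Real.pi) ^ ((d : ℝ) / 2) * Real.Gamma (((d : ℝ) + 2) / 2)) *
    ∑ v ∈ V, 1 / Real.sqrt (-hessian h v).det

end UMax

end

namespace UMax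

/-! ### Poisson approximation of the probability that no event occurs -/

section Poisson

/-! Write `d = m - 1` and put the threshold at `M - η²`, where `η = √t · n ^ (-(d+1)/d)`. The
rescaled gap is at most `t` exactly when some increasing `m`-tuple of indices has kernel value at
least `M - η²`. Among the `n.choose m` such rare events, those over disjoint tuples are independent,
so the number `W` that occur should be nearly Poisson, and `ℙ(W = 0)` nearly `exp (-𝔼 W)`.

The Poisson step (`abs_measure_no_event_sub_exp_le`) uses the generating function `G u = 𝔼[(1 - u) ^
W]`. Local dependence gives `G' ≈ -λ G` on `[0, 1]` with `λ = 𝔼 W`, and the integrating factor `exp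
(λ u)` turns this into a bound on `|G 1 - exp (-λ)|`, where `G 1 = ℙ(W = 0)`.

The mean: central angles seen from one point are independent and uniform (`iIndepFun_centralAngle`),
so one exceedance has probability `(2π)⁻ᵈ` times the volume of `{h ≥ M - η²}`. Near each maximum,
Taylor's formula makes this set an ellipsoid up to relative error `O(η)`, so the probability is `K
ηᵈ + O(η ^ (d+1))` (`KernelConditions.exists_exceedanceProb_bound`). Since `n ^ (d+1) * η ^ d = t ^
(d/2)`, `λ` tends to `t ^ (d/2) K / m!`.

The dependence: for two overlapping tuples, symmetry lets both be viewed from a shared point, and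
each index of the second outside the first then costs a factor `O(η)`
(`KernelConditions.measureReal_exceedance_inter_le`). There are at most of order `n ^ s` ways to
choose `s` new indices, and `n η = √t · n ^ (-1/d)`; the terms with `s = 1` determine the order of
the resulting bound. Every other error is `O(n ^ (-1/d))` too, and
`KernelConditions.abs_measure_no_exceedance_sub_exp_le_mul` collects them. -/

lemma abs_pow_add_sub_pow_le {q : ℝ} (h0 : 0 ≤ q) (h1 : q ≤ 1) (a z : ℕ) :
    |q ^ (a + z) - q ^ a| ≤ z := by
  rcases Nat.eq_zero_or_pos z with rfl | hz
  · simp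
  · have h2 : q ^ (a + z) ≤ 1 := pow_le_one₀ h0 h1
    have h3 : q ^ a ≤ 1 := pow_le_one₀ h0 h1
    have h4 : 0 ≤ q ^ (a + z) := pow_nonneg h0 _
    have h5 : 0 ≤ q ^ a := pow_nonneg h0 _
    have h6 : (1 : ℝ) ≤ z := by exact_mod_cast hz
    rw [abs_le]
    constructor <;> linarith

variable {Ω : Type*} [MeasurableSpace Ω] {μ : Measure Ω}

/-- The derivative of the generating function `u ↦ 𝔼[(1 - u) ^ W]`. -/
lemma hasDerivAt_integral_one_sub_pow [IsProbabilityMeasure μ] {W : Ω → ℕ} (hW : Measurable W)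
    {N : ℕ} (hN : ∀ ω, W ω ≤ N) {u : ℝ} (hu : u ∈ Icc (0 : ℝ) 1) :
    HasDerivAt (fun u => ∫ ω, (1 - u) ^ W ω ∂μ)
      (-∫ ω, (W ω : ℝ) * (1 - u) ^ (W ω - 1) ∂μ) u := by
  have hmeas : ∀ x : ℝ, Measurable fun ω => (1 - x) ^ W ω := fun x =>
    (measurable_of_countable fun k : ℕ => (1 - x) ^ k).comp hW
  have hmeas' : ∀ x : ℝ, Measurable fun ω => -((W ω : ℝ) * (1 - x) ^ (W ω - 1)) := fun x =>
    (measurable_of_countable fun k : ℕ => -((k : ℝ) * (1 - x) ^ (k - 1))).comp hW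
  rw [← integral_neg]
  refine (hasDerivAt_integral_of_dominated_loc_of_deriv_le (bound := fun _ => (N : ℝ) * 3 ^ N)
    (F' := fun x ω => -((W ω : ℝ) * (1 - x) ^ (W ω - 1)))
    (Metric.ball_mem_nhds u one_pos) (Eventually.of_forall fun x => (hmeas x).aestronglyMeasurable)
    ?_ (hmeas' u).aestronglyMeasurable ?_ (integrable_const _) ?_).2
  · refine Integrable.of_bound (hmeas u).aestronglyMeasurable 1 (Eventually.of_forall fun ω => ?_)
    rw [norm_pow]
    refine pow_le_one₀ (norm_nonneg _) ?_
    rw [Real.norm_eq_abs, abs_le]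
    constructor <;> linarith [hu.1, hu.2]
  · refine Eventually.of_forall fun ω x hx => ?_
    -- On the unit ball around `u ∈ [0, 1]` one has `|1 - x| ≤ 2`; the constant `3` is merely
    -- convenient.
    have hx3 : ‖1 - x‖ ≤ 3 := by
      rw [Metric.mem_ball, Real.dist_eq, abs_lt] at hx
      rw [Real.norm_eq_abs, abs_le]
      constructor <;> linarith [hu.1, hu.2, hx.1, hx.2]
    rw [norm_neg, norm_mul, norm_pow, Real.norm_natCast]
    have h1 : (W ω : ℝ) ≤ N := by exact_mod_cast hN ω
    have h2 : ‖1 - x‖ ^ (W ω - 1) ≤ 3 ^ N :=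
      (pow_le_pow_left₀ (norm_nonneg _) hx3 _).trans
        (pow_le_pow_right₀ (by norm_num) ((Nat.sub_le _ _).trans (hN ω)))
    gcongr
  · refine Eventually.of_forall fun ω x _ => ?_
    have := ((hasDerivAt_id x).const_sub 1).pow (W ω)
    exact this.congr_deriv (by simp)

variable {ι : Type*}

/-- The number of events `A i`, `i ∈ s`, that occur. -/
noncomputable def countOn {Ω ι : Type*} (A : ι → Set Ω) (s : Finset ι) (ω : Ω) : ℕ :=
  ∑ i ∈ s, (A i).indicator (fun _ => 1) ω

lemma measurable_countOn {A : ι → Set Ω} (hA : ∀ i, MeasurableSet (A i)) (s : Finset ι) :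
    Measurable (countOn A s) :=
  Finset.measurable_fun_sum _ fun i _ => measurable_const.indicator (hA i)

lemma cast_countOn {Ω : Type*} (A : ι → Set Ω) (s : Finset ι) (ω : Ω) :
    (countOn A s ω : ℝ) = ∑ i ∈ s, (A i).indicator (fun _ => (1 : ℝ)) ω := by
  simp only [countOn, Nat.cast_sum]
  refine Finset.sum_congr rfl fun i _ => ?_
  by_cases h : ω ∈ A i <;> simp [h]

lemma integral_countOn [IsProbabilityMeasure μ] {A : ι → Set Ω} (hA : ∀ i, MeasurableSet (A i))
    (s : Finset ι) : ∫ ω, (countOn A s ω : ℝ) ∂μ = ∑ i ∈ s, μ.real (A i) := by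
  simp_rw [cast_countOn]
  rw [integral_finsetSum _ fun i _ => (integrable_const _).indicator (hA i)]
  refine Finset.sum_congr rfl fun i _ => ?_
  rw [integral_indicator (hA i)]
  simp

lemma integral_indicator_mul_countOn [IsProbabilityMeasure μ] {A : ι → Set Ω}
    (hA : ∀ i, MeasurableSet (A i)) (i : ι) (s : Finset ι) :
    ∫ ω, (A i).indicator (fun _ => (1 : ℝ)) ω * (countOn A s ω : ℝ) ∂μ =
      ∑ j ∈ s, μ.real (A i ∩ A j) := by
  simp_rw [cast_countOn, Finset.mul_sum]
  have h : ∀ j ω, (A i).indicator (fun _ => (1 : ℝ)) ω * (A j).indicator (fun _ => (1 : ℝ)) ω =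
      (A i ∩ A j).indicator (fun _ => (1 : ℝ)) ω := fun j ω => by
    by_cases h1 : ω ∈ A i <;> by_cases h2 : ω ∈ A j <;> simp [h1, h2]
  simp_rw [h]
  rw [integral_finsetSum _ fun j _ => (integrable_const _).indicator ((hA i).inter (hA j))]
  refine Finset.sum_congr rfl fun j _ => ?_
  rw [integral_indicator ((hA i).inter (hA j))]
  simp

lemma countOn_le {Ω : Type*} (A : ι → Set Ω) (s : Finset ι) (ω : Ω) : countOn A s ω ≤ s.card := by
  refine (Finset.sum_le_card_nsmul s _ 1 fun i _ => ?_).trans (by simp)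
  exact indicator_le_self' (fun _ _ => zero_le_one) ω

lemma integrable_countOn_comp [IsProbabilityMeasure μ] {A : ι → Set Ω}
    (hA : ∀ i, MeasurableSet (A i)) (s : Finset ι) (φ : ℕ → ℝ) :
    Integrable (fun ω => φ (countOn A s ω)) μ := by
  have hm : Measurable fun ω => φ (countOn A s ω) :=
    (measurable_of_countable φ).comp (measurable_countOn hA s)
  refine Integrable.of_bound hm.aestronglyMeasurable (∑ k ∈ Finset.range (s.card + 1), ‖φ k‖)
    (Eventually.of_forall fun ω => ?_)
  exact Finset.single_le_sum (f := fun k => ‖φ k‖) (fun _ _ => norm_nonneg _)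
    (Finset.mem_range.2 (Nat.lt_succ_of_le (countOn_le A s ω)))

lemma integrable_indicator_mul [IsProbabilityMeasure μ] {A : Set Ω} (hA : MeasurableSet A)
    {g : Ω → ℝ} (hg : Integrable g μ) :
    Integrable (fun ω => A.indicator (fun _ => (1 : ℝ)) ω * g ω) μ := by
  have : (fun ω => A.indicator (fun _ => (1 : ℝ)) ω * g ω) = A.indicator g := by
    ext ω
    by_cases h : ω ∈ A <;> simp [h]
  rw [this]
  exact hg.indicator hA

/-- The comparison of `𝔼[1_{A i} (1 - u) ^ (W - 1)]` with `ℙ(A i) 𝔼[(1 - u) ^ W]`. -/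
lemma abs_integral_indicator_mul_pow_sub_le [Fintype ι] [DecidableEq ι] [IsProbabilityMeasure μ] {A : ι → Set Ω}
    (hA : ∀ i, MeasurableSet (A i)) {i : ι} {s : Finset ι} (his : i ∈ s)
    (hind : IndepFun ((A i).indicator fun _ => (1 : ℝ)) (countOn A sᶜ) μ)
    {q : ℝ} (h0 : 0 ≤ q) (h1 : q ≤ 1) :
    |∫ ω, (A i).indicator (fun _ => (1 : ℝ)) ω * q ^ (countOn A Finset.univ ω - 1) ∂μ -
        μ.real (A i) * ∫ ω, q ^ countOn A Finset.univ ω ∂μ| ≤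
      ∑ j ∈ s, μ.real (A i) * μ.real (A j) + ∑ j ∈ s.erase i, μ.real (A i ∩ A j) := by
  set X : Ω → ℝ := (A i).indicator fun _ => (1 : ℝ) with hX
  have hsplit : ∀ ω, countOn A Finset.univ ω = countOn A sᶜ ω + countOn A s ω := fun ω => by
    simp only [countOn]
    rw [add_comm, Finset.sum_add_sum_compl]
  -- On `A i` the event `i ∈ s` itself is counted, so the truncated subtraction just removes it.
  have hsplit' : ∀ ω ∈ A i, countOn A Finset.univ ω - 1 =
      countOn A sᶜ ω + countOn A (s.erase i) ω := fun ω hω => by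
    have : countOn A s ω = countOn A (s.erase i) ω + 1 := by
      simp only [countOn]
      rw [← Finset.sum_erase_add s _ his]
      simp [hω]
    rw [hsplit, this]
    omega
  have hprod : ∫ ω, X ω * q ^ countOn A sᶜ ω ∂μ = μ.real (A i) * ∫ ω, q ^ countOn A sᶜ ω ∂μ := by
    have h2 : IndepFun X (fun ω => q ^ countOn A sᶜ ω) μ :=
      hind.comp (φ := id) (ψ := fun k : ℕ => q ^ k) measurable_id (measurable_of_countable _)
    have h3 := h2.integral_fun_mul_eq_mul_integral
      (measurable_const.indicator (hA i)).aestronglyMeasurable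
      (integrable_countOn_comp hA sᶜ fun k => q ^ k).aestronglyMeasurable
    rw [h3, hX, integral_indicator (hA i)]
    simp
  -- Dropping the neighbours from the exponent costs at most the number of neighbours that occur
  -- together with `A i`.
  have hb1 : |∫ ω, X ω * q ^ (countOn A Finset.univ ω - 1) ∂μ - ∫ ω, X ω * q ^ countOn A sᶜ ω ∂μ| ≤
      ∑ j ∈ s.erase i, μ.real (A i ∩ A j) := by
    rw [← integral_indicator_mul_countOn hA, ← integral_sub
      (integrable_indicator_mul (hA i) (integrable_countOn_comp hA _ fun k => q ^ (k - 1)))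
      (integrable_indicator_mul (hA i) (integrable_countOn_comp hA _ fun k => q ^ k))]
    refine norm_integral_le_of_norm_le (f := fun ω => X ω * q ^ (countOn A Finset.univ ω - 1) -
        X ω * q ^ countOn A sᶜ ω) (integrable_indicator_mul (hA i)
      (integrable_countOn_comp hA _ fun k => (k : ℝ))) (Eventually.of_forall fun ω => ?_)
    by_cases h : ω ∈ A i
    · simp only [hX, indicator_of_mem h, one_mul, hsplit' ω h]
      exact abs_pow_add_sub_pow_le h0 h1 _ _
    · simp [hX, h]
  have hb2 : |∫ ω, q ^ countOn A sᶜ ω ∂μ - ∫ ω, q ^ countOn A Finset.univ ω ∂μ| ≤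
      ∑ j ∈ s, μ.real (A j) := by
    rw [← integral_countOn hA, ← integral_sub (integrable_countOn_comp hA _ fun k => q ^ k)
      (integrable_countOn_comp hA _ fun k => q ^ k)]
    refine norm_integral_le_of_norm_le (f := fun ω => q ^ countOn A sᶜ ω -
        q ^ countOn A Finset.univ ω) (integrable_countOn_comp hA _ fun k => (k : ℝ))
      (Eventually.of_forall fun ω => ?_)
    rw [hsplit, norm_sub_rev]
    exact abs_pow_add_sub_pow_le h0 h1 _ _
  rw [hprod] at hb1
  have hp : 0 ≤ μ.real (A i) := measureReal_nonneg
  have hb3 : |μ.real (A i) * ∫ ω, q ^ countOn A sᶜ ω ∂μ -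
      μ.real (A i) * ∫ ω, q ^ countOn A Finset.univ ω ∂μ| ≤
      ∑ j ∈ s, μ.real (A i) * μ.real (A j) := by
    rw [← mul_sub, abs_mul, abs_of_nonneg hp, ← Finset.mul_sum]
    exact mul_le_mul_of_nonneg_left hb2 hp
  exact (abs_sub_le _ _ _).trans (by linarith)

/-- Poisson approximation for the probability that none of the locally dependent events `A i`
occurs, with dependency neighbourhoods `N i`. -/
theorem abs_measure_no_event_sub_exp_le [Fintype ι] [DecidableEq ι] [IsProbabilityMeasure μ] {A : ι → Set Ω}
    (hA : ∀ i, MeasurableSet (A i)) (N : ι → Finset ι) (hN : ∀ i, i ∈ N i)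
    (hind : ∀ i, IndepFun ((A i).indicator fun _ => (1 : ℝ)) (countOn A (N i)ᶜ) μ) :
    |μ.real (⋂ i, (A i)ᶜ) - Real.exp (-∑ i, μ.real (A i))| ≤
      ∑ i, (∑ j ∈ N i, μ.real (A i) * μ.real (A j) +
        ∑ j ∈ (N i).erase i, μ.real (A i ∩ A j)) := by
  set W : Ω → ℕ := countOn A Finset.univ with hW
  set lam : ℝ := ∑ i, μ.real (A i) with hlam
  set b : ℝ := ∑ i, (∑ j ∈ N i, μ.real (A i) * μ.real (A j) +
    ∑ j ∈ (N i).erase i, μ.real (A i ∩ A j)) with hb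
  set G : ℝ → ℝ := fun u => ∫ ω, (1 - u) ^ W ω ∂μ with hG
  have hlam0 : 0 ≤ lam := Finset.sum_nonneg fun i _ => measureReal_nonneg
  have hG0 : G 0 = 1 := by simp [hG]
  have hG1 : G 1 = μ.real (⋂ i, (A i)ᶜ) := by
    -- Since `0 ^ 0 = 1`, the function `0 ^ W` is the indicator of `W = 0`.
    have h1 : (fun ω => ((1 : ℝ) - 1) ^ W ω) = (⋂ i, (A i)ᶜ).indicator fun _ => (1 : ℝ) := by
      ext ω
      by_cases h : ω ∈ ⋂ i, (A i)ᶜ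
      · rw [indicator_of_mem h]
        have : W ω = 0 := Finset.sum_eq_zero fun i _ =>
          indicator_of_notMem (mem_iInter.1 h i) _
        simp [this]
      · rw [indicator_of_notMem h]
        have : W ω ≠ 0 := by
          simp only [mem_iInter, mem_compl_iff, not_forall, not_not] at h
          obtain ⟨i, hi⟩ := h
          intro h0
          have := Finset.sum_eq_zero_iff.1 h0 i (Finset.mem_univ i)
          simp [hi] at this
        simp [this]
    simp only [hG, h1]
    rw [integral_indicator (MeasurableSet.iInter fun i => (hA i).compl)]
    simp
  have hder : ∀ u ∈ Icc (0 : ℝ) 1,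
      HasDerivAt (fun u => Real.exp (lam * u) * G u)
        (Real.exp (lam * u) * (lam * G u - ∫ ω, (W ω : ℝ) * (1 - u) ^ (W ω - 1) ∂μ)) u := by
    intro u hu
    have h1 := hasDerivAt_integral_one_sub_pow (μ := μ) (measurable_countOn hA Finset.univ)
      (countOn_le A Finset.univ) hu
    have h2 : HasDerivAt (fun u => Real.exp (lam * u)) (Real.exp (lam * u) * lam) u := by
      have := ((hasDerivAt_id u).const_mul lam).exp
      simpa using this
    exact (h2.mul h1).congr_deriv (by ring)
  have hbound : ∀ u ∈ Icc (0 : ℝ) 1,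
      |lam * G u - ∫ ω, (W ω : ℝ) * (1 - u) ^ (W ω - 1) ∂μ| ≤ b := by
    intro u hu
    have h1 : ∫ ω, (W ω : ℝ) * (1 - u) ^ (W ω - 1) ∂μ =
        ∑ i, ∫ ω, (A i).indicator (fun _ => (1 : ℝ)) ω * (1 - u) ^ (W ω - 1) ∂μ := by
      rw [← integral_finsetSum _ fun i _ => integrable_indicator_mul (hA i)
        (integrable_countOn_comp hA _ fun k => (1 - u) ^ (k - 1))]
      simp only [hW, cast_countOn, Finset.sum_mul]
    rw [h1, hlam, Finset.sum_mul, ← Finset.sum_sub_distrib]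
    refine (Finset.abs_sum_le_sum_abs _ _).trans (Finset.sum_le_sum fun i _ => ?_)
    rw [abs_sub_comm]
    exact abs_integral_indicator_mul_pow_sub_le hA (hN i) (hind i) (by linarith [hu.2])
      (by linarith [hu.1])
  have hmv := norm_image_sub_le_of_norm_deriv_le_segment_01' (C := Real.exp lam * b)
    (fun u hu => (hder u hu).hasDerivWithinAt) (fun u hu => by
      have hu' : u ∈ Icc (0 : ℝ) 1 := ⟨hu.1, hu.2.le⟩
      rw [norm_mul, Real.norm_eq_abs, Real.norm_eq_abs, abs_of_pos (Real.exp_pos _)]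
      refine mul_le_mul (Real.exp_le_exp.2 ?_) (hbound u hu') (abs_nonneg _) (Real.exp_pos _).le
      nlinarith [hu.2])
  rw [mul_one, mul_zero, Real.exp_zero, hG0, hG1, one_mul, Real.norm_eq_abs] at hmv
  have h2 : μ.real (⋂ i, (A i)ᶜ) - Real.exp (-lam) =
      Real.exp (-lam) * (Real.exp lam * μ.real (⋂ i, (A i)ᶜ) - 1) := by
    rw [mul_sub, ← mul_assoc, ← Real.exp_add]
    simp
  rw [h2, abs_mul, abs_of_pos (Real.exp_pos _)]
  calc Real.exp (-lam) * |Real.exp lam * μ.real (⋂ i, (A i)ᶜ) - 1|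
      ≤ Real.exp (-lam) * (Real.exp lam * b) := by gcongr
    _ = b := by rw [← mul_assoc, ← Real.exp_add]; simp

end Poisson

end UMax

namespace UMax

/-! ### Central angles of uniform points on the circle -/

section Angle

/-- The angle of a point of the circle, in `[0, 2π)`. -/
noncomputable def angle (z : Circle) : ℝ :=
  if (z : ℂ).arg < 0 then (z : ℂ).arg + 2 * Real.pi else (z : ℂ).arg

lemma angle_mem (z : Circle) : angle z ∈ Ico (0 : ℝ) (2 * Real.pi) := by
  have h1 := Complex.neg_pi_lt_arg (z : ℂ)
  have h2 := Complex.arg_le_pi (z : ℂ)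
  have h3 := Real.pi_pos
  unfold angle
  split_ifs with h
  · constructor <;> linarith
  · constructor <;> linarith

lemma exp_angle (z : Circle) : Circle.exp (angle z) = z := by
  unfold angle
  split_ifs
  · rw [Circle.exp_add, Circle.exp_two_pi, mul_one, Circle.exp_arg]
  · exact Circle.exp_arg z

lemma measurable_angle : Measurable angle := by
  have h : Measurable fun z : Circle => (z : ℂ).arg :=
    Complex.measurable_arg.comp (show Continuous fun z : Circle => (z : ℂ) by fun_prop).measurable
  exact Measurable.ite (measurableSet_lt h measurable_const) (h.add_const _) h

lemma angle_exp {θ : ℝ} (hθ : θ ∈ Ico (0 : ℝ) (2 * Real.pi)) : angle (Circle.exp θ) = θ := by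
  obtain ⟨k, hk⟩ := Circle.exp_eq_exp.1 (exp_angle (Circle.exp θ))
  have h1 := angle_mem (Circle.exp θ)
  have hpi := Real.two_pi_pos
  have hk0 : k = 0 := by
    have h2 : (k : ℝ) * (2 * Real.pi) < 1 * (2 * Real.pi) := by linarith [h1.2, hθ.1]
    have h3 : (-1) * (2 * Real.pi) < (k : ℝ) * (2 * Real.pi) := by linarith [h1.1, hθ.2]
    have h4 : (k : ℝ) < 1 := lt_of_mul_lt_mul_right h2 hpi.le
    have h5 : (-1 : ℝ) < k := lt_of_mul_lt_mul_right h3 hpi.le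
    have h6 : k < 1 := by exact_mod_cast h4
    have h7 : -1 < k := by exact_mod_cast h5
    omega
  simpa [hk0] using hk

/-- The uniform distribution on `[0, 2π)`. -/
noncomputable def uniformAngle : Measure ℝ :=
  ENNReal.ofReal (1 / (2 * Real.pi)) • volume.restrict (Ico (0 : ℝ) (2 * Real.pi))

instance : IsProbabilityMeasure uniformAngle := by
  constructor
  rw [uniformAngle, Measure.smul_apply, Measure.restrict_apply_univ, Real.volume_Ico, smul_eq_mul,
    ← ENNReal.ofReal_mul (by positivity), sub_zero, one_div, inv_mul_cancel₀ Real.two_pi_pos.ne',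
    ENNReal.ofReal_one]

lemma uniformCircle_eq_map : uniformCircle = uniformAngle.map Circle.exp := rfl

instance : IsProbabilityMeasure uniformCircle := by
  rw [uniformCircle_eq_map]
  exact Measure.isProbabilityMeasure_map Circle.exp.continuous.aemeasurable

lemma map_angle_uniformCircle : uniformCircle.map angle = uniformAngle := by
  rw [uniformCircle_eq_map, Measure.map_map measurable_angle Circle.exp.continuous.measurable]
  have h : angle ∘ Circle.exp =ᵐ[uniformAngle] id := by
    refine Measure.ae_smul_measure ?_ _
    exact (ae_restrict_iff' measurableSet_Ico).2 (Eventually.of_forall fun θ hθ => angle_exp hθ)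
  rw [Measure.map_congr h, Measure.map_id]

/-- Any two intervals of length `T` are fundamental domains for translation by `ℤ T`, so an
invariant set meets them in equal measure. -/
lemma volume_inter_Ico_eq_of_periodic {P : Set ℝ} (hP : MeasurableSet P) {T : ℝ} (hT : 0 < T)
    (hper : ∀ x, x + T ∈ P ↔ x ∈ P) (a : ℝ) :
    volume (P ∩ Ico a (a + T)) = volume (P ∩ Ico 0 T) := by
  have hz : ∀ (k : ℤ) x, x + k * T ∈ P ↔ x ∈ P := by
    intro k
    induction k using Int.induction_on with
    | zero => simp
    | succ k ih =>
      intro x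
      have := hper (x + k * T)
      push_cast at ih ⊢
      rw [ih] at this
      rw [← this, add_assoc, add_one_mul]
    | pred k ih =>
      intro x
      have := hper (x + (-k - 1) * T)
      push_cast at ih ⊢
      rw [← this, ← ih x, add_assoc, ← add_one_mul, sub_add_cancel]
  have h := (isAddFundamentalDomain_Ioc hT a volume).measure_set_eq
    (isAddFundamentalDomain_Ioc hT 0 volume) hP (by
      rintro ⟨g, hg⟩
      obtain ⟨k, rfl⟩ := AddSubgroup.mem_zmultiples_iff.1 hg
      ext x
      have := hz k x
      simpa [AddSubgroup.vadd_def, add_comm] using this)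
  rw [zero_add] at h
  have e : ∀ s t : ℝ, volume (P ∩ Ico s t) = volume (P ∩ Ioc s t) := fun s t =>
    measure_congr ((ae_eq_refl P).inter Ico_ae_eq_Ioc)
  rw [e, e, h]

/-- In the angle coordinate, multiplication by `z` is translation by `angle z`. It moves the window
`[0, 2π)`, which does not matter for a `2π`-periodic set. -/
lemma uniformCircle_preimage_mul (z : Circle) {B : Set Circle} (hB : MeasurableSet B) :
    uniformCircle ((fun w => z * w) ⁻¹' B) = uniformCircle B := by
  have hexp : Measurable Circle.exp := Circle.exp.continuous.measurable
  have key : ∀ {C : Set Circle}, MeasurableSet C → uniformCircle C =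
      ENNReal.ofReal (1 / (2 * Real.pi)) * volume (Circle.exp ⁻¹' C ∩ Ico 0 (2 * Real.pi)) := by
    intro C hC
    rw [uniformCircle, Measure.map_apply hexp hC, Measure.smul_apply,
      Measure.restrict_apply (hexp hC), smul_eq_mul]
  rw [key ((measurable_const_mul z) hB), key hB]
  congr 1
  set a := angle z
  rw [← volume_inter_Ico_eq_of_periodic (hexp hB) Real.two_pi_pos (fun x => by
    simp [Circle.exp_add]) a]
  have : Circle.exp ⁻¹' ((fun w => z * w) ⁻¹' B) ∩ Ico 0 (2 * Real.pi) =
      (fun x => a + x) ⁻¹' (Circle.exp ⁻¹' B ∩ Ico a (a + 2 * Real.pi)) := by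
    ext x
    simp [a, Circle.exp_add, exp_angle]
  rw [this, measure_preimage_add]

end Angle

/-! ### Independence and law of the central angles from a fixed point. -/

section Independence

variable {Ω : Type*} [MeasurableSpace Ω] {μ : Measure Ω} [IsProbabilityMeasure μ]
  {U : ℕ → Ω → Circle}

/-- For a fixed value of `U j`, rotation invariance makes the quotients independent and uniform.
Their law does not depend on that value, so Fubini applies with a constant inner measure. -/
lemma measure_iInter_quotient_mem (hm : ∀ i, Measurable (U i)) (hind : iIndepFun U μ)
    (hunif : ∀ i, μ.map (U i) = uniformCircle) {j : ℕ} {T : Finset ℕ} (hj : j ∉ T)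
    {B : ℕ → Set Circle} (hB : ∀ i, MeasurableSet (B i)) :
    μ (⋂ i ∈ T, (fun ω => (U j ω)⁻¹ * U i ω) ⁻¹' B i) = ∏ i ∈ T, uniformCircle (B i) := by
  have hT : iIndepFun (fun i : T => U i) μ := hind.precomp Subtype.val_injective
  have hY : μ.map (fun ω (i : T) => U i ω) = Measure.pi fun _ => uniformCircle := by
    rw [(iIndepFun_iff_map_fun_eq_pi_map fun i : T => (hm i).aemeasurable).1 hT]
    simp only [hunif]
  have hYm : Measurable fun ω (i : T) => U i ω := measurable_pi_lambda _ fun i => hm i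
  have hXY : IndepFun (U j) (fun ω (i : T) => U i ω) μ := by
    have := hind.indepFun_finset {j} T (by simpa using hj) hm
    exact this.comp (φ := fun y : ({j} : Finset ℕ) → Circle => y ⟨j, Finset.mem_singleton_self j⟩) (ψ := id)
      (measurable_pi_apply _) measurable_id
  have hprod := (indepFun_iff_map_prod_eq_prod_map_map (hm j).aemeasurable hYm.aemeasurable).1 hXY
  set E : Set (Circle × (T → Circle)) := {q | ∀ i : T, q.1⁻¹ * q.2 i ∈ B i} with hE
  have hEm : MeasurableSet E := by
    rw [hE, ofPred_forall]
    refine MeasurableSet.iInter fun i => ?_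
    have : Measurable fun q : Circle × (T → Circle) => q.1⁻¹ * q.2 i :=
      measurable_fst.inv.mul ((measurable_pi_apply i).comp measurable_snd)
    exact this (hB i)
  have h1 : (⋂ i ∈ T, (fun ω => (U j ω)⁻¹ * U i ω) ⁻¹' B i) =
      (fun ω => (U j ω, fun i : T => U i ω)) ⁻¹' E := by
    ext ω
    simp [hE]
  rw [h1, ← Measure.map_apply ((hm j).prodMk hYm) hEm, hprod, hY, hunif, Measure.prod_apply hEm]
  have h2 : ∀ z : Circle, (Measure.pi fun _ : T => uniformCircle) (Prod.mk z ⁻¹' E) =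
      ∏ i ∈ T, uniformCircle (B i) := by
    intro z
    have : Prod.mk z ⁻¹' E = Set.pi univ fun i : T => (fun w => z⁻¹ * w) ⁻¹' B i := by
      ext w
      simp [hE]
    rw [this, Measure.pi_pi]
    simp_rw [uniformCircle_preimage_mul _ (hB _)]
    exact Finset.prod_coe_sort T fun i => uniformCircle (B i)
  simp [h2]

/-- The central angle from `U j` to `U i`. -/
noncomputable def centralAngle {Ω : Type*} (U : ℕ → Ω → Circle) (j i : ℕ) (ω : Ω) : ℝ :=
  angle ((U j ω)⁻¹ * U i ω)

lemma measurable_centralAngle {Ω : Type*} [MeasurableSpace Ω] {U : ℕ → Ω → Circle} (hm : ∀ i, Measurable (U i)) (j i : ℕ) :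
    Measurable (centralAngle U j i) :=
  measurable_angle.comp ((hm j).inv.mul (hm i))

lemma map_centralAngle (hm : ∀ i, Measurable (U i)) (hind : iIndepFun U μ)
    (hunif : ∀ i, μ.map (U i) = uniformCircle) {j i : ℕ} (hij : i ≠ j) :
    μ.map (centralAngle U j i) = uniformAngle := by
  rw [← map_angle_uniformCircle]
  have : μ.map (fun ω => (U j ω)⁻¹ * U i ω) = uniformCircle := by
    ext B hB
    rw [Measure.map_apply (by fun_prop) hB]
    have := measure_iInter_quotient_mem (T := {i}) (B := fun _ => B) hm hind hunif
      (by simpa using hij.symm) fun _ => hB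
    simpa using this
  rw [← this, Measure.map_map measurable_angle (by fun_prop)]
  rfl

/-- The central angles from one of the points to the others are independent. -/
lemma iIndepFun_centralAngle (hm : ∀ i, Measurable (U i)) (hind : iIndepFun U μ)
    (hunif : ∀ i, μ.map (U i) = uniformCircle) (j : ℕ) :
    iIndepFun (fun i : {i // i ≠ j} => centralAngle U j i) μ := by
  classical
  suffices h : iIndepFun (fun (i : {i // i ≠ j}) ω => (U j ω)⁻¹ * U i ω) μ from
    h.comp (fun _ => angle) fun _ => measurable_angle
  rw [iIndepFun_iff_measure_inter_preimage_eq_mul]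
  intro S B hB
  -- The family is extended by `univ` to all of `ℕ`, where the product formula is stated.
  set B' : ℕ → Set Circle := fun i => if h : i ≠ j ∧ ∃ hi : i ≠ j, ⟨i, hi⟩ ∈ S then B ⟨i, h.1⟩
    else univ with hB'
  have hB'm : ∀ i, MeasurableSet (B' i) := by
    intro i
    simp only [hB']
    split_ifs with h
    · exact hB _ h.2.2
    · exact MeasurableSet.univ
  have hB'eq : ∀ i ∈ S, B' i = B i := by
    intro i hi
    simp only [hB']
    rw [dif_pos ⟨i.2, i.2, hi⟩]
  -- Subsets of `S` are allowed so that singletons identify the factors.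
  have main : ∀ S' ⊆ S, μ (⋂ i ∈ S', (fun ω => (U j ω)⁻¹ * U i ω) ⁻¹' B i) =
      ∏ i ∈ S', uniformCircle (B i) := by
    intro S' hS'
    have h1 := measure_iInter_quotient_mem (j := j) (T := S'.map (Function.Embedding.subtype _))
      hm hind hunif (by simp) hB'm
    rw [Finset.prod_map] at h1
    rw [Finset.prod_congr rfl fun i hi => by rw [← hB'eq i (hS' hi)]]
    rw [show (⋂ i ∈ S', (fun ω => (U j ω)⁻¹ * U (i : ℕ) ω) ⁻¹' B i) =
      ⋂ i ∈ S'.map (Function.Embedding.subtype _), (fun ω => (U j ω)⁻¹ * U i ω) ⁻¹' B' i from ?_]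
    · exact h1
    · ext ω
      simp only [mem_iInter, Finset.mem_map, forall_exists_index, and_imp]
      constructor
      · rintro h _ i hi rfl
        rw [Function.Embedding.subtype_apply, hB'eq i (hS' hi)]
        exact h i hi
      · intro h i hi
        rw [← hB'eq i (hS' hi)]
        exact h _ i hi rfl
  rw [main S subset_rfl]
  refine Finset.prod_congr rfl fun i hi => ?_
  have := main {i} (by simpa using hi)
  simpa using this.symm

end Independence

end UMax

namespace UMax

/-! ### Probabilities of exceedances of the kernel -/

section Exceedance

variable {d : ℕ} {f : (Fin (d + 1) → Circle) → EReal} {h : (Fin d → ℝ) → EReal} {M : ℝ}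
  {V : Finset (Fin d → ℝ)}

/-- The part of the cube of central angles where `h` is at least `c`. -/
def superlevel (h : (Fin d → ℝ) → EReal) (c : EReal) : Set (Fin d → ℝ) :=
  {β | β ∈ angleCube d ∧ c ≤ h β}

lemma isCompact_angleCube (d : ℕ) : IsCompact (angleCube d) := by
  have : angleCube d = Set.pi univ fun _ => Icc (0 : ℝ) (2 * Real.pi) := by
    ext β
    simp only [angleCube, mem_ofPred_eq, mem_univ_pi]
  rw [this]
  exact isCompact_univ_pi fun _ => isCompact_Icc

lemma KernelConditions.isClosed_superlevel (hf : KernelConditions f h M V) (c : EReal) :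
    IsClosed (superlevel h c) :=
  hf.continuousOn.preimage_isClosed_of_isClosed (isCompact_angleCube d).isClosed isClosed_Ici

lemma KernelConditions.kernel_eq (hf : KernelConditions f h M V) (u : Fin (d + 1) → Circle) :
    f u = h fun k => angle ((u 0)⁻¹ * u k.succ) := by
  rw [← hf.rotation_invariant (u 0) _ fun k => angle_mem _]
  congr 1
  ext1 i
  refine Fin.cases ?_ (fun k => ?_) i
  · simp
  · simp [exp_angle]

lemma KernelConditions.le_kernel_iff (hf : KernelConditions f h M V) {c : EReal}
    {u : Fin (d + 1) → Circle} :
    c ≤ f u ↔ (fun k : Fin d => angle ((u 0)⁻¹ * u k.succ)) ∈ superlevel h c := by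
  rw [hf.kernel_eq]
  exact ⟨fun hc => ⟨fun k => Ico_subset_Icc_self (angle_mem _), hc⟩, fun hc => hc.2⟩

/-- Measurability of `f` is not assumed; it comes from continuity of `h` on the closed cube. -/
lemma KernelConditions.measurableSet_le (hf : KernelConditions f h M V) (c : EReal) :
    MeasurableSet {u | c ≤ f u} := by
  have hm : Measurable fun (u : Fin (d + 1) → Circle) (k : Fin d) =>
      angle ((u 0)⁻¹ * u k.succ) :=
    measurable_pi_lambda _ fun k =>
      measurable_angle.comp ((measurable_pi_apply _).inv.mul (measurable_pi_apply _))
  have : {u | c ≤ f u} = (fun (u : Fin (d + 1) → Circle) (k : Fin d) =>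
      angle ((u 0)⁻¹ * u k.succ)) ⁻¹' superlevel h c := by
    ext u
    exact hf.le_kernel_iff
  rw [this]
  exact hm (hf.isClosed_superlevel c).measurableSet

/-- The event that the kernel is at least `c` on the points with indices `K 0, …, K d`. -/
def exceedance {Ω : Type*} (f : (Fin (d + 1) → Circle) → EReal) (c : EReal)
    (U : ℕ → Ω → Circle) (K : Fin (d + 1) → ℕ) : Set Ω :=
  {ω | c ≤ f fun i => U (K i) ω}

lemma KernelConditions.exceedance_perm (hf : KernelConditions f h M V) {Ω : Type*} (c : EReal)
    (U : ℕ → Ω → Circle) (K : Fin (d + 1) → ℕ) (σ : Equiv.Perm (Fin (d + 1))) :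
    exceedance f c U (K ∘ σ) = exceedance f c U K := by
  ext ω
  have := hf.symmetric σ fun i => U (K i) ω
  simp only [exceedance, mem_ofPred_eq]
  rw [← this]
  rfl

lemma KernelConditions.exceedance_eq (hf : KernelConditions f h M V) {Ω : Type*} (c : EReal)
    (U : ℕ → Ω → Circle) (K : Fin (d + 1) → ℕ) :
    exceedance f c U K =
      (fun ω (k : Fin d) => centralAngle U (K 0) (K k.succ) ω) ⁻¹' superlevel h c := by
  ext ω
  exact hf.le_kernel_iff

variable {Ω : Type*} [MeasurableSpace Ω] {μ : Measure Ω} {U : ℕ → Ω → Circle}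

lemma KernelConditions.measurableSet_exceedance (hf : KernelConditions f h M V)
    (hm : ∀ i, Measurable (U i)) (c : EReal) (K : Fin (d + 1) → ℕ) :
    MeasurableSet (exceedance f c U K) :=
  (measurable_pi_lambda (fun ω i => U (K i) ω) fun i => hm (K i)) (hf.measurableSet_le c)

/-- The probability that the kernel of uniform points is at least `c`. -/
noncomputable def exceedanceProb (h : (Fin d → ℝ) → EReal) (c : EReal) : ℝ :=
  (Measure.pi fun _ : Fin d => uniformAngle).real (superlevel h c)

/-- Independence of an event depending on the coordinates in the range of `K` from a product event
on other coordinates. -/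
lemma measureReal_inter_iInter_eq_mul {κ ι : Type*} [Fintype ι] [DecidableEq κ]
    {Z : κ → Ω → ℝ}
    (hm : ∀ i, Measurable (Z i)) (hind : iIndepFun Z μ) (K : ι → κ) {S : Set (ι → ℝ)}
    (hS : MeasurableSet S) {T : Finset κ} (hT : ∀ i, K i ∉ T) {I : κ → Set ℝ}
    (hI : ∀ i, MeasurableSet (I i)) :
    μ.real ((fun ω i => Z (K i) ω) ⁻¹' S ∩ ⋂ i ∈ T, Z i ⁻¹' I i) =
      μ.real ((fun ω i => Z (K i) ω) ⁻¹' S) * ∏ i ∈ T, μ.real (Z i ⁻¹' I i) := by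
  set T₁ : Finset κ := Finset.univ.image K
  have hdisj : Disjoint T₁ T := by
    rw [Finset.disjoint_left]
    rintro _ hi
    obtain ⟨i, -, rfl⟩ := Finset.mem_image.1 hi
    exact hT i
  have h1 := hind.indepFun_finset T₁ T hdisj hm
  have h2 := h1.measure_inter_preimage_eq_mul
    ((fun (y : T₁ → ℝ) (i : ι) => y ⟨K i, Finset.mem_image_of_mem _ (Finset.mem_univ i)⟩) ⁻¹' S)
    (⋂ i : T, (fun y : T → ℝ => y i) ⁻¹' I i)
    ((measurable_pi_lambda _ fun i => measurable_pi_apply _) hS)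
    (MeasurableSet.iInter fun i => (measurable_pi_apply i) (hI i))
  have h3 : (fun ω (i : T) => Z i ω) ⁻¹' (⋂ i : T, (fun y : T → ℝ => y i) ⁻¹' I i) =
      ⋂ i ∈ T, Z i ⁻¹' I i := by
    ext ω
    simp
  have h4 := hind.measure_inter_preimage_eq_mul T fun i _ => hI i
  rw [h3, h4] at h2
  have h5 := congrArg ENNReal.toReal h2
  rw [ENNReal.toReal_mul, ENNReal.toReal_prod] at h5
  exact h5

/-- The exceedance for an index tuple is independent of the number of exceedances over tuples which
are disjoint from it. -/
lemma KernelConditions.indepFun_countOn (hf : KernelConditions f h M V)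
    (hm : ∀ i, Measurable (U i)) (hind : iIndepFun U μ) (c : EReal) {ι : Type*} [Fintype ι]
    (K : ι → Fin (d + 1) → ℕ) (i : ι) {s : Finset ι}
    (hs : ∀ j ∈ s, Disjoint (Finset.univ.image (K i)) (Finset.univ.image (K j))) :
    IndepFun ((exceedance f c U (K i)).indicator fun _ => (1 : ℝ))
      (countOn (fun j => exceedance f c U (K j)) s) μ := by
  classical
  set T : Finset ℕ := s.biUnion fun j => Finset.univ.image (K j) with hT
  have hdisj : Disjoint (Finset.univ.image (K i)) T := by
    rw [hT, Finset.disjoint_biUnion_right]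
    exact hs
  have h1 := hind.indepFun_finset _ T hdisj hm
  -- A function of finitely many coordinates is extended by a dummy value `1`, which is never read
  -- at an index tuple contained in `S`.
  set ext : ∀ S : Finset ℕ, (S → Circle) → ℕ → Circle := fun S y k =>
    if hk : k ∈ S then y ⟨k, hk⟩ else 1 with hext
  have hextm : ∀ (S : Finset ℕ) (k : ℕ), Measurable fun y => ext S y k := by
    intro S k
    by_cases hk : k ∈ S
    · simp only [hext, hk, dite_true]
      exact measurable_pi_apply _
    · simp only [hext, hk, dite_false]
      exact measurable_const
  have hset : ∀ (S : Finset ℕ) (L : Fin (d + 1) → ℕ),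
      MeasurableSet {y : S → Circle | c ≤ f fun a => ext S y (L a)} := fun S L =>
    (measurable_pi_lambda (fun y a => ext S y (L a)) fun a => hextm S (L a)) (hf.measurableSet_le c)
  have hpre : ∀ (S : Finset ℕ) (L : Fin (d + 1) → ℕ), Finset.univ.image L ⊆ S →
      exceedance f c U L =
        (fun ω (k : S) => U k ω) ⁻¹' {y : S → Circle | c ≤ f fun a => ext S y (L a)} := by
    intro S L hL
    have hval : ∀ ω, (fun a => ext S (fun k : S => U k ω) (L a)) = fun a => U (L a) ω := by
      intro ω
      ext1 a
      have : L a ∈ S := hL (Finset.mem_image_of_mem _ (Finset.mem_univ a))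
      simp [hext, this]
    ext ω
    change c ≤ f _ ↔ c ≤ f _
    rw [hval]
  have hφ : Measurable ({y | c ≤ f fun a =>
      ext (Finset.univ.image (K i)) y (K i a)}.indicator fun _ => (1 : ℝ)) :=
    measurable_const.indicator (hset _ _)
  have h2 := h1.comp (ψ := countOn (fun j => {y | c ≤ f fun a => ext T y (K j a)}) s)
    hφ (measurable_countOn (fun j => hset _ _) s)
  convert h2 using 1
  · rw [hpre _ (K i) subset_rfl]
    rfl
  · ext ω
    refine Finset.sum_congr rfl fun j hj => ?_
    beta_reduce
    rw [hpre T (K j) (Finset.subset_biUnion_of_mem (fun j => Finset.univ.image (K j)) hj)]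
    rfl

variable [IsProbabilityMeasure μ]

lemma KernelConditions.measureReal_exceedance (hf : KernelConditions f h M V)
    (hm : ∀ i, Measurable (U i)) (hind : iIndepFun U μ)
    (hunif : ∀ i, μ.map (U i) = uniformCircle) (c : EReal) {K : Fin (d + 1) → ℕ}
    (hK : Function.Injective K) :
    μ.real (exceedance f c U K) = exceedanceProb h c := by
  have hne : ∀ k : Fin d, K k.succ ≠ K 0 := fun k hk => Fin.succ_ne_zero k (hK hk)
  have hi : iIndepFun (fun k : Fin d => centralAngle U (K 0) (K k.succ)) μ :=
    (iIndepFun_centralAngle hm hind hunif (K 0)).precomp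
      (g := fun k : Fin d => (⟨K k.succ, hne k⟩ : {i // i ≠ K 0}))
      fun a b hab => Fin.succ_injective _ (hK (congrArg Subtype.val hab))
  have hmap := (iIndepFun_iff_map_fun_eq_pi_map
    fun k : Fin d => (measurable_centralAngle hm (K 0) (K k.succ)).aemeasurable).1 hi
  simp_rw [fun k => map_centralAngle hm hind hunif (hne k)] at hmap
  rw [exceedanceProb, ← hmap, map_measureReal_apply
    (measurable_pi_lambda _ fun k => measurable_centralAngle hm _ _)
    (hf.isClosed_superlevel c).measurableSet, hf.exceedance_eq]

lemma measureReal_uniformAngle_ball_le (x : ℝ) {ρ : ℝ} (hρ : 0 ≤ ρ) :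
    uniformAngle.real (Metric.ball x ρ) ≤ ρ := by
  have h1 : uniformAngle (Metric.ball x ρ) ≤
      ENNReal.ofReal (1 / (2 * Real.pi)) * ENNReal.ofReal (2 * ρ) := by
    rw [uniformAngle, Measure.smul_apply, smul_eq_mul, ← Real.volume_ball]
    exact mul_le_mul_right (Measure.restrict_apply_le _ _) _
  rw [← ENNReal.ofReal_mul (by positivity)] at h1
  refine (ENNReal.toReal_le_of_le_ofReal (by positivity) h1).trans ?_
  have hpi : (1 : ℝ) ≤ Real.pi := by linarith [Real.pi_gt_three]
  calc 1 / (2 * Real.pi) * (2 * ρ) = ρ / Real.pi := by field_simp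
    _ ≤ ρ := div_le_self hρ hpi

/-- From the common first point, the angles at indices of `K'` outside `K` are independent of the
exceedance for `K`. The exceedance for `K'` forces each of them to within `ρ` of a coordinate of
some maximum; a union bound over `V` finishes. -/
lemma KernelConditions.measureReal_exceedance_inter_le_of_zero (hf : KernelConditions f h M V)
    (hm : ∀ i, Measurable (U i)) (hind : iIndepFun U μ)
    (hunif : ∀ i, μ.map (U i) = uniformCircle) {c : EReal} {ρ : ℝ} (hρ : 0 ≤ ρ)
    (hsub : superlevel h c ⊆ ⋃ v ∈ V, Metric.ball v ρ) {K K' : Fin (d + 1) → ℕ}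
    (hK : Function.Injective K) (hK' : Function.Injective K') (h0 : K 0 = K' 0) :
    μ.real (exceedance f c U K ∩ exceedance f c U K') ≤
      V.card * (exceedanceProb h c *
        ρ ^ (Finset.univ.image K' \ Finset.univ.image K).card) := by
  classical
  have hne : ∀ k : Fin d, K k.succ ≠ K 0 := fun k hk => Fin.succ_ne_zero k (hK hk)
  have hne' : ∀ k : Fin d, K' k.succ ≠ K 0 := fun k hk => Fin.succ_ne_zero k (hK' (hk.trans h0))
  set κ := {i // i ≠ K 0}
  set Z : κ → Ω → ℝ := fun i => centralAngle U (K 0) i with hZ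
  have hZm : ∀ i, Measurable (Z i) := fun i => measurable_centralAngle hm _ _
  have hZi : iIndepFun Z μ := iIndepFun_centralAngle hm hind hunif (K 0)
  set L : Fin d → κ := fun k => ⟨K k.succ, hne k⟩
  set L' : Fin d → κ := fun k => ⟨K' k.succ, hne' k⟩
  have hL' : Function.Injective L' := fun a b hab =>
    Fin.succ_injective _ (hK' (congrArg Subtype.val hab))
  set R : Finset (Fin d) := Finset.univ.filter fun k => ∀ i, L i ≠ L' k with hR
  set T : Finset κ := R.image L' with hT
  have hcard : (Finset.univ.image K' \ Finset.univ.image K).card = R.card := by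
    have : Finset.univ.image K' \ Finset.univ.image K = R.image fun k => K' k.succ := by
      ext i
      simp only [Finset.mem_sdiff, Finset.mem_image, Finset.mem_univ, true_and, hR,
        Finset.mem_filter]
      constructor
      · rintro ⟨⟨a, rfl⟩, ha⟩
        refine Fin.cases (fun ha => absurd ⟨0, h0⟩ ha) (fun k hk => ?_) a ha
        exact ⟨k, fun j hj => hk ⟨j.succ, congrArg Subtype.val hj⟩, rfl⟩
      · rintro ⟨k, hk, rfl⟩
        refine ⟨⟨_, rfl⟩, ?_⟩
        rintro ⟨a, ha⟩
        refine Fin.cases (fun ha => hne' k ha.symm) (fun j hj => ?_) a ha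
        exact hk j (Subtype.ext hj)
    rw [this, Finset.card_image_of_injective _ fun a b hab => Fin.succ_injective _ (hK' hab)]
  have hE : exceedance f c U K = (fun ω k => Z (L k) ω) ⁻¹' superlevel h c := hf.exceedance_eq c U K
  have hE' : exceedance f c U K' = (fun ω k => Z (L' k) ω) ⁻¹' superlevel h c := by
    rw [hf.exceedance_eq c U K', ← h0]
  -- As `L'` is injective, at most one `k` contributes at each index; elsewhere the intersection is
  -- everything.
  set I : (Fin d → ℝ) → κ → Set ℝ := fun v i =>
    ⋂ k : Fin d, ⋂ _ : L' k = i, Metric.ball (v k) ρ with hI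
  have hIL : ∀ v k, I v (L' k) = Metric.ball (v k) ρ := by
    intro v k
    ext x
    simp only [hI, mem_iInter]
    exact ⟨fun hx => hx k rfl, fun hx j hj => by rwa [hL' hj]⟩
  have hincl : exceedance f c U K ∩ exceedance f c U K' ⊆
      ⋃ v ∈ V, (exceedance f c U K ∩ ⋂ i ∈ T, Z i ⁻¹' I v i) := by
    rintro ω ⟨hω, hω'⟩
    rw [hE'] at hω'
    obtain ⟨v, hv, hvb⟩ := mem_iUnion₂.1 (hsub hω')
    refine mem_iUnion₂.2 ⟨v, hv, hω, mem_iInter₂.2 fun i hi => ?_⟩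
    obtain ⟨k, -, rfl⟩ := Finset.mem_image.1 hi
    rw [mem_preimage, hIL]
    rw [Metric.mem_ball] at hvb ⊢
    exact (dist_le_pi_dist (fun k => Z (L' k) ω) v k).trans_lt hvb
  have hbound : ∀ v ∈ V, μ.real (exceedance f c U K ∩ ⋂ i ∈ T, Z i ⁻¹' I v i) ≤
      exceedanceProb h c * ρ ^ R.card := by
    intro v _
    rw [hE, measureReal_inter_iInter_eq_mul hZm hZi L (hf.isClosed_superlevel c).measurableSet
      (T := T) (fun i hi => by
        obtain ⟨k, hk, hki⟩ := Finset.mem_image.1 hi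
        exact (Finset.mem_filter.1 hk).2 i hki.symm)
      (fun i => MeasurableSet.iInter fun k => MeasurableSet.iInter fun _ => measurableSet_ball),
      ← hE, hf.measureReal_exceedance hm hind hunif c hK, hT,
      Finset.prod_image fun a _ b _ hab => hL' hab]
    refine mul_le_mul_of_nonneg_left ?_ measureReal_nonneg
    refine (Finset.prod_le_prod (fun _ _ => measureReal_nonneg) fun k _ => ?_).trans_eq
      (Finset.prod_const ρ)
    change μ.real (Z (L' k) ⁻¹' I v (L' k)) ≤ ρ
    rw [hIL]
    have := map_centralAngle hm hind hunif (hne' k)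
    rw [← map_measureReal_apply (hZm _) measurableSet_ball]
    simp only [hZ, L']
    rw [this]
    exact measureReal_uniformAngle_ball_le _ hρ
  rw [hcard]
  calc μ.real (exceedance f c U K ∩ exceedance f c U K')
      ≤ μ.real (⋃ v ∈ V, (exceedance f c U K ∩ ⋂ i ∈ T, Z i ⁻¹' I v i)) :=
        measureReal_mono hincl (measure_ne_top _ _)
    _ ≤ ∑ v ∈ V, μ.real (exceedance f c U K ∩ ⋂ i ∈ T, Z i ⁻¹' I v i) :=
        measureReal_biUnion_finset_le _ _
    _ ≤ ∑ v ∈ V, exceedanceProb h c * ρ ^ R.card := Finset.sum_le_sum hbound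
    _ = _ := by rw [Finset.sum_const, nsmul_eq_mul]

/-- The probability of a joint exceedance for two overlapping index tuples. -/
lemma KernelConditions.measureReal_exceedance_inter_le (hf : KernelConditions f h M V)
    (hm : ∀ i, Measurable (U i)) (hind : iIndepFun U μ)
    (hunif : ∀ i, μ.map (U i) = uniformCircle) {c : EReal} {ρ : ℝ} (hρ : 0 ≤ ρ)
    (hsub : superlevel h c ⊆ ⋃ v ∈ V, Metric.ball v ρ) {K K' : Fin (d + 1) → ℕ}
    (hK : Function.Injective K) (hK' : Function.Injective K')
    (hne : ¬Disjoint (Finset.univ.image K) (Finset.univ.image K')) :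
    μ.real (exceedance f c U K ∩ exceedance f c U K') ≤
      V.card * (exceedanceProb h c *
        ρ ^ (Finset.univ.image K' \ Finset.univ.image K).card) := by
  rw [Finset.not_disjoint_iff] at hne
  obtain ⟨i, hi, hi'⟩ := hne
  obtain ⟨a, -, ha⟩ := Finset.mem_image.1 hi
  obtain ⟨b, -, hb⟩ := Finset.mem_image.1 hi'
  have himg : ∀ (L : Fin (d + 1) → ℕ) (σ : Equiv.Perm (Fin (d + 1))),
      Finset.univ.image (L ∘ σ) = Finset.univ.image L := fun L σ => by
    rw [← Finset.image_image, Finset.image_univ_equiv]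
  -- Symmetry of the kernel allows a shared index to be swapped into position `0` of both tuples.
  have := hf.measureReal_exceedance_inter_le_of_zero (K := K ∘ Equiv.swap 0 a)
    (K' := K' ∘ Equiv.swap 0 b) hm hind hunif hρ hsub (hK.comp (Equiv.injective _))
    (hK'.comp (Equiv.injective _)) (by simp [ha, hb])
  rwa [hf.exceedance_perm, hf.exceedance_perm, himg, himg] at this

end Exceedance

end UMax

namespace UMax

/-! ### Poisson approximation for exceedances of the kernel -/

section Counting

/-- `B` is determined by `B ∩ A`, with at most `2 ^ |A|` choices, and by `B \ A`, with at most `n ^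
s` choices when it has `s` elements. -/
lemma sum_pow_card_sdiff_le (A : Finset ℕ) (F : Finset (Finset ℕ)) (n : ℕ) (I : Finset ℕ)
    (hF : ∀ B ∈ F, B ⊆ Finset.range n) (hI : ∀ B ∈ F, (B \ A).card ∈ I) {x : ℝ} (hx : 0 ≤ x) :
    ∑ B ∈ F, x ^ (B \ A).card ≤ 2 ^ A.card * ∑ s ∈ I, ((n : ℝ) * x) ^ s := by
  rw [← Finset.sum_fiberwise_of_maps_to hI, Finset.mul_sum]
  refine Finset.sum_le_sum fun s _ => ?_
  rw [Finset.sum_congr rfl fun B hB => by rw [(Finset.mem_filter.1 hB).2], Finset.sum_const,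
    nsmul_eq_mul, mul_pow, ← mul_assoc]
  refine mul_le_mul_of_nonneg_right ?_ (pow_nonneg hx s)
  have h1 : (F.filter fun B => (B \ A).card = s).card ≤
      (A.powerset ×ˢ (Finset.range n).powersetCard s).card := by
    refine Finset.card_le_card_of_injOn (fun B => (B ∩ A, B \ A)) ?_ ?_
    · intro B hB
      have hB' := Finset.mem_filter.1 (Finset.mem_coe.1 hB)
      simp only [Finset.coe_product, mem_prod, Finset.mem_coe, Finset.mem_powerset,
        Finset.mem_powersetCard]
      exact ⟨Finset.inter_subset_right, Finset.sdiff_subset.trans (hF B hB'.1), hB'.2⟩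
    · intro B _ B' _ h
      simp only [Prod.mk.injEq] at h
      rw [← Finset.sdiff_union_inter B A, ← Finset.sdiff_union_inter B' A, h.1, h.2]
  rw [Finset.card_product, Finset.card_powerset, Finset.card_powersetCard, Finset.card_range] at h1
  calc ((F.filter fun B => (B \ A).card = s).card : ℝ) ≤ (2 ^ A.card * n.choose s : ℕ) := by
        exact_mod_cast h1
    _ ≤ (2 ^ A.card * n ^ s : ℕ) := by
        exact_mod_cast Nat.mul_le_mul_left _ (Nat.choose_le_pow n s)
    _ = 2 ^ A.card * (n : ℝ) ^ s := by push_cast; rfl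

/-- The indices of an increasing tuple, as natural numbers. -/
def indices {m n : ℕ} (J : Fin m ↪o Fin n) (i : Fin m) : ℕ := J i

lemma indices_injective {m n : ℕ} (J : Fin m ↪o Fin n) : Function.Injective (indices J) :=
  Fin.val_injective.comp J.injective

/-- The set of indices of an increasing tuple. -/
def indexSet {m n : ℕ} (J : Fin m ↪o Fin n) : Finset ℕ := Finset.univ.image (indices J)

lemma card_indexSet {m n : ℕ} (J : Fin m ↪o Fin n) : (indexSet J).card = m := by
  rw [indexSet, Finset.card_image_of_injective _ (indices_injective J), Finset.card_univ,
    Fintype.card_fin]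

lemma indexSet_subset {m n : ℕ} (J : Fin m ↪o Fin n) : indexSet J ⊆ Finset.range n := by
  intro i hi
  obtain ⟨k, -, rfl⟩ := Finset.mem_image.1 hi
  exact Finset.mem_range.2 (J k).2

lemma indexSet_injective {m n : ℕ} :
    Function.Injective (indexSet : (Fin m ↪o Fin n) → Finset ℕ) := by
  intro J J' h
  refine OrderEmbedding.range_inj.1 ?_
  ext i
  have h1 : ∀ L : Fin m ↪o Fin n, i ∈ range L ↔ (i : ℕ) ∈ indexSet L := fun L => by
    simp [indexSet, indices, Fin.val_inj]
  rw [h1, h1, h]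

lemma card_orderEmbedding_fin (m n : ℕ) [Fintype (Fin m ↪o Fin n)] :
    Fintype.card (Fin m ↪o Fin n) = n.choose m := by
  rw [← Nat.card_eq_fintype_card, Nat.card_congr Set.powersetCard.ofFinEmbEquiv,
    Set.powersetCard.card, Nat.card_fin]

end Counting

section Approximation

variable {d : ℕ} {f : (Fin (d + 1) → Circle) → EReal} {h : (Fin d → ℝ) → EReal} {M : ℝ}
  {V : Finset (Fin d → ℝ)} {Ω : Type*} [MeasurableSpace Ω] {μ : Measure Ω}
  [IsProbabilityMeasure μ] {U : ℕ → Ω → Circle}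

lemma sum_overlapping_le {m n : ℕ} (J : Fin m ↪o Fin n) (N : Finset (Fin m ↪o Fin n))
    (I : Finset ℕ) (hI : ∀ J' ∈ N, (indexSet J' \ indexSet J).card ∈ I) {x : ℝ} (hx : 0 ≤ x) :
    ∑ J' ∈ N, x ^ (indexSet J' \ indexSet J).card ≤ 2 ^ m * ∑ s ∈ I, ((n : ℝ) * x) ^ s := by
  have h1 := sum_pow_card_sdiff_le (indexSet J) (N.image indexSet) n I
    (by simpa using fun J' _ => indexSet_subset J') (by simpa using hI) hx
  rwa [Finset.sum_image fun a _ b _ hab => indexSet_injective hab, card_indexSet] at h1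

/-- The probability that the kernel does not exceed `c` on the first `n` points, compared with its
Poisson approximation. -/
theorem KernelConditions.abs_measure_no_exceedance_sub_exp_le (hf : KernelConditions f h M V)
    (hm : ∀ i, Measurable (U i)) (hind : iIndepFun U μ)
    (hunif : ∀ i, μ.map (U i) = uniformCircle) {c : EReal} {ρ : ℝ} (hρ : 0 ≤ ρ)
    (hsub : superlevel h c ⊆ ⋃ v ∈ V, Metric.ball v ρ) (n : ℕ) :
    |μ.real (⋂ J : Fin (d + 1) ↪o Fin n, (exceedance f c U (indices J))ᶜ) -
        Real.exp (-(n.choose (d + 1) * exceedanceProb h c))| ≤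
      n.choose (d + 1) * (exceedanceProb h c ^ 2 * (2 ^ (d + 1) *
          ∑ s ∈ Finset.range (d + 1), (n : ℝ) ^ s) +
        V.card * exceedanceProb h c * (2 ^ (d + 1) *
          ∑ s ∈ Finset.Icc 1 d, ((n : ℝ) * ρ) ^ s)) := by
  classical
  set p := exceedanceProb h c
  have hp0 : 0 ≤ p := measureReal_nonneg
  set N : (Fin (d + 1) ↪o Fin n) → Finset (Fin (d + 1) ↪o Fin n) := fun J =>
    Finset.univ.filter fun J' => ¬Disjoint (indexSet J) (indexSet J') with hN
  have hprob : ∀ J : Fin (d + 1) ↪o Fin n, μ.real (exceedance f c U (indices J)) = p := fun J =>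
    hf.measureReal_exceedance hm hind hunif c (indices_injective J)
  have hcard : ∀ J, ∀ J' ∈ N J, (indexSet J' \ indexSet J).card ≤ d := by
    intro J J' hJ'
    have h1 := (Finset.mem_filter.1 hJ').2
    rw [Finset.not_disjoint_iff_nonempty_inter] at h1
    have h2 := Finset.card_sdiff_add_card_inter (indexSet J') (indexSet J)
    rw [card_indexSet, Finset.inter_comm] at h2
    have := h1.card_pos
    omega
  -- A different tuple of the same size brings at least one new index. This excludes `s = 0` from
  -- the joint term, which would not be small.
  have hcard' : ∀ J J' : Fin (d + 1) ↪o Fin n, J' ≠ J →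
      1 ≤ (indexSet J' \ indexSet J).card := by
    intro J J' hJ
    rw [Nat.one_le_iff_ne_zero, Ne, Finset.card_eq_zero, Finset.sdiff_eq_empty_iff_subset]
    intro hs
    exact hJ (indexSet_injective (Finset.eq_of_subset_of_card_le hs
      (by rw [card_indexSet, card_indexSet])))
  have key := abs_measure_no_event_sub_exp_le (μ := μ)
    (A := fun J : Fin (d + 1) ↪o Fin n => exceedance f c U (indices J))
    (fun J => hf.measurableSet_exceedance hm c _) N
    (fun J => by
      refine Finset.mem_filter.2 ⟨Finset.mem_univ J, ?_⟩
      rw [disjoint_self]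
      exact Finset.card_pos.1 (by rw [card_indexSet]; omega) |>.ne_empty)
    (fun J => hf.indepFun_countOn hm hind c (fun J => indices J) J (s := (N J)ᶜ) fun J' hJ' => by
      by_contra hcon
      exact Finset.mem_compl.1 hJ' (Finset.mem_filter.2 ⟨Finset.mem_univ J', hcon⟩))
  simp only [hprob, Finset.sum_const, Finset.card_univ, card_orderEmbedding_fin, nsmul_eq_mul]
    at key
  refine key.trans ?_
  refine (Finset.sum_le_card_nsmul _ _ _ fun J _ => ?_).trans_eq (by
    rw [Finset.card_univ, card_orderEmbedding_fin, nsmul_eq_mul])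
  refine add_le_add ?_ ?_
  -- With `x = 1` the weighted sum simply counts the overlapping tuples.
  · have h1 := sum_overlapping_le J (N J) (Finset.range (d + 1))
      (fun J' hJ' => Finset.mem_range.2 (Nat.lt_succ_of_le (hcard J J' hJ'))) zero_le_one
    simp only [one_pow, Finset.sum_const, nsmul_eq_mul, mul_one] at h1
    calc ((N J).card : ℝ) * (p * p) = p ^ 2 * (N J).card := by ring
      _ ≤ _ := by gcongr
  · have h1 := sum_overlapping_le J ((N J).erase J) (Finset.Icc 1 d)
      (fun J' hJ' => Finset.mem_Icc.2 ⟨hcard' J J' (Finset.ne_of_mem_erase hJ'),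
        hcard J J' (Finset.mem_of_mem_erase hJ')⟩) hρ
    refine le_trans (Finset.sum_le_sum fun J' hJ' =>
      hf.measureReal_exceedance_inter_le hm hind hunif hρ hsub (indices_injective J)
        (indices_injective J') (Finset.mem_filter.1 (Finset.mem_of_mem_erase hJ')).2) ?_
    rw [← Finset.mul_sum, ← Finset.mul_sum, ← mul_assoc]
    gcongr
    exact h1

end Approximation

end UMax

namespace UMax

/-! ### Local structure of the kernel at its points of maximum -/

section Taylor

variable {E : Type*} [NormedAddCommGroup E] [NormedSpace ℝ E]

/-- The second order Taylor formula at a critical point, with a cubic remainder. -/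
lemma exists_abs_sub_taylor_two_le {g : E → ℝ} {v : E} (hg : ContDiffAt ℝ 3 g v)
    (hcrit : fderiv ℝ g v = 0) :
    ∃ L : ℝ, 0 ≤ L ∧ ∃ r > 0, ∀ x ∈ Metric.ball v r,
      |g x - g v - 1 / 2 * fderiv ℝ (fderiv ℝ g) v (x - v) (x - v)| ≤ L * ‖x - v‖ ^ 3 := by
  have hev : ∀ᶠ x in 𝓝 v, ContDiffAt ℝ 3 g x := hg.eventually (by simp)
  have h1 : ContDiffAt ℝ 2 (fderiv ℝ g) v := hg.fderiv_right (by norm_num)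
  have h2 : ContDiffAt ℝ 1 (fderiv ℝ (fderiv ℝ g)) v := h1.fderiv_right (by norm_num)
  obtain ⟨L, t, ht, hL⟩ := h2.exists_lipschitzOnWith
  obtain ⟨r, hr, hball⟩ := Metric.mem_nhds_iff.1 (inter_mem ht hev)
  set D := fderiv ℝ (fderiv ℝ g) v with hD
  have hsymm : ∀ a b, D a b = D b a := fun a b => by
    have := hg.isSymmSndFDerivAt (by rw [minSmoothness_of_isRCLikeNormedField]; norm_num)
    exact this.eq a b
  refine ⟨L, L.2, r, hr, fun x hx => ?_⟩
  set ρ := ‖x - v‖ with hρ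
  have hρ0 : 0 ≤ ρ := norm_nonneg _
  have hsub : Metric.closedBall v ρ ⊆ Metric.ball v r := by
    intro y hy
    rw [Metric.mem_ball, dist_eq_norm] at hx
    rw [Metric.mem_closedBall] at hy
    exact Metric.mem_ball.2 (hy.trans_lt hx)
  have hv : v ∈ Metric.closedBall v ρ := Metric.mem_closedBall_self hρ0
  have hxm : x ∈ Metric.closedBall v ρ := by rw [Metric.mem_closedBall, dist_eq_norm]
  have hnorm : ∀ y ∈ Metric.closedBall v ρ, ‖y - v‖ ≤ ρ := fun y hy => by
    rwa [Metric.mem_closedBall, dist_eq_norm] at hy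
  have hlin : ∀ y, HasFDerivAt (fun y => D (y - v)) D y := fun y =>
    D.hasFDerivAt.comp y ((hasFDerivAt_id y).sub_const v)
  -- The Lipschitz bound `L ρ` on the change of the second derivative is integrated twice by the
  -- mean value inequality: `L ρ²` for the gradient here, `L ρ³` for the function below.
  have hgrad : ∀ y ∈ Metric.closedBall v ρ, ‖fderiv ℝ g y - D (y - v)‖ ≤ L * ρ * ρ := by
    intro y hy
    have := (convex_closedBall v ρ).norm_image_sub_le_of_norm_hasFDerivWithin_le
      (f := fun y => fderiv ℝ g y - D (y - v)) (f' := fun y => fderiv ℝ (fderiv ℝ g) y - D)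
      (C := L * ρ) (fun z hz => by
        have hz' : ContDiffAt ℝ 3 g z := (hball (hsub hz)).2
        have hz'' : ContDiffAt ℝ 2 (fderiv ℝ g) z := hz'.fderiv_right (by norm_num)
        exact ((hz''.differentiableAt (by norm_num)).hasFDerivAt.sub (hlin z)).hasFDerivWithinAt)
      (fun z hz => by
        refine (hL.norm_sub_le (hball (hsub hz)).1 (hball (hsub hv)).1).trans ?_
        gcongr
        exact hnorm z hz) hv hy
    simp only [hcrit, sub_self, map_zero, sub_zero] at this
    refine this.trans ?_
    gcongr
    exact hnorm y hy
  have := (convex_closedBall v ρ).norm_image_sub_le_of_norm_hasFDerivWithin_le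
    (f := fun y => g y - 1 / 2 * D (y - v) (y - v)) (f' := fun y => fderiv ℝ g y - D (y - v))
    (C := L * ρ * ρ) (fun z hz => by
      have hz' : ContDiffAt ℝ 3 g z := (hball (hsub hz)).2
      have hq : HasFDerivAt (fun y => 1 / 2 * D (y - v) (y - v)) (D (z - v)) z := by
        have := ((hlin z).clm_apply ((hasFDerivAt_id z).sub_const v)).const_mul (1 / 2)
        refine this.congr_fderiv ?_
        ext w
        simp only [smul_apply, add_apply,
          ContinuousLinearMap.comp_apply, ContinuousLinearMap.flip_apply,
          ContinuousLinearMap.id_apply, smul_eq_mul, id]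
        rw [hsymm w (z - v)]
        ring
      exact ((hz'.differentiableAt (by norm_num)).hasFDerivAt.sub hq).hasFDerivWithinAt)
    hgrad hv hxm
  simp only [sub_self, map_zero, mul_zero, sub_zero] at this
  rw [Real.norm_eq_abs] at this
  calc |g x - g v - 1 / 2 * D (x - v) (x - v)| = |g x - 1 / 2 * D (x - v) (x - v) - g v| := by
        congr 1; ring
    _ ≤ L * ρ * ρ * ρ := this
    _ = L * ρ ^ 3 := by ring

/-- At a maximum the second derivative is negative semidefinite. -/
lemma second_fderiv_apply_nonpos {g : E → ℝ} {v : E} {L r : ℝ} {D : E →L[ℝ] E →L[ℝ] ℝ}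
    (hr : 0 < r) (htaylor : ∀ x ∈ Metric.ball v r,
      |g x - g v - 1 / 2 * D (x - v) (x - v)| ≤ L * ‖x - v‖ ^ 3)
    (hmax : ∀ x ∈ Metric.ball v r, g x ≤ g v) (y : E) : D y y ≤ 0 := by
  -- At `v + s y`, after division by `s²`, the cubic remainder is `O(s)`.
  have hlim : Tendsto (fun s : ℝ => 2 * L * s * ‖y‖ ^ 3) (𝓝[>] 0) (𝓝 0) := by
    have : Tendsto (fun s : ℝ => 2 * L * s * ‖y‖ ^ 3) (𝓝 0) (𝓝 (2 * L * 0 * ‖y‖ ^ 3)) :=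
      Continuous.tendsto (by fun_prop) 0
    simpa using this.mono_left nhdsWithin_le_nhds
  refine ge_of_tendsto hlim ?_
  have hsmall : ∀ᶠ s : ℝ in 𝓝[>] 0, v + s • y ∈ Metric.ball v r := by
    have : Tendsto (fun s : ℝ => v + s • y) (𝓝 0) (𝓝 (v + (0 : ℝ) • y)) :=
      Continuous.tendsto (by fun_prop) 0
    rw [zero_smul, add_zero] at this
    exact nhdsWithin_le_nhds (this (Metric.ball_mem_nhds v hr))
  filter_upwards [hsmall, self_mem_nhdsWithin] with s hs hs0
  have hs0' : 0 < s := hs0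
  have h1 := htaylor _ hs
  have h2 := hmax _ hs
  rw [add_sub_cancel_left, norm_smul, Real.norm_eq_abs, abs_of_pos hs0'] at h1
  simp only [map_smul, smul_apply, smul_eq_mul] at h1
  have h3 := (abs_le.1 h1).1
  have h4 : 1 / 2 * (s * (s * D y y)) ≤ L * (s * ‖y‖) ^ 3 := by linarith
  have h5 : s ^ 2 * D y y ≤ s ^ 2 * (2 * L * s * ‖y‖ ^ 3) := by nlinarith
  exact le_of_mul_le_mul_left h5 (by positivity)

end Taylor

end UMax

namespace UMax

/-! ### Positive definite quadratic forms and volumes of ellipsoids. -/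

section Quadratic

variable {d : ℕ}

open scoped MatrixOrder Matrix.Norms.L2Operator in
-- This factorization writes the Hessian form as `½ |B y|²`, so its sublevel sets are linear
-- preimages of Euclidean balls.
lemma exists_eq_transpose_mul_self {A : Matrix (Fin d) (Fin d) ℝ} (hA : A.PosSemidef) :
    ∃ B : Matrix (Fin d) (Fin d) ℝ, A = B.transpose * B := by
  obtain ⟨B, hB⟩ := CStarAlgebra.nonneg_iff_eq_star_mul_self.mp hA.nonneg
  exact ⟨B, by rw [hB, Matrix.star_eq_conjTranspose, Matrix.conjTranspose_eq_transpose_of_trivial]⟩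

/-- The quadratic form `y ↦ ½ |B y|²`. -/
noncomputable def halfSq (B : Matrix (Fin d) (Fin d) ℝ) (y : Fin d → ℝ) : ℝ :=
  1 / 2 * ∑ i, (B.mulVec y) i ^ 2

lemma halfSq_eq_dotProduct (B : Matrix (Fin d) (Fin d) ℝ) (y : Fin d → ℝ) :
    halfSq B y = 1 / 2 * (y ⬝ᵥ (B.transpose * B).mulVec y) := by
  rw [halfSq, ← Matrix.mulVec_mulVec, Matrix.dotProduct_mulVec, Matrix.vecMul_transpose]
  simp only [dotProduct, sq]

/-- Coercivity comes from boundedness of `B⁻¹`. The norm here is the sup norm, which the Euclidean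
one dominates. -/
lemma exists_mul_norm_sq_le_halfSq {B : Matrix (Fin d) (Fin d) ℝ} (hB : B.det ≠ 0) :
    ∃ c > 0, ∀ y, c * ‖y‖ ^ 2 ≤ halfSq B y := by
  obtain ⟨C, hC0, hC⟩ := (LinearMap.toContinuousLinearMap (Matrix.mulVecLin B⁻¹)).bound
  refine ⟨1 / (2 * C ^ 2), by positivity, fun y => ?_⟩
  have h1 : ‖y‖ ≤ C * ‖B.mulVec y‖ := by
    have := hC (B.mulVec y)
    simp only [LinearMap.coe_toContinuousLinearMap', Matrix.mulVecLin_apply,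
      Matrix.mulVec_mulVec, Matrix.nonsing_inv_mul _ (isUnit_iff_ne_zero.2 hB),
      Matrix.one_mulVec] at this
    exact this
  have h2 : ‖B.mulVec y‖ ^ 2 ≤ ∑ i, (B.mulVec y) i ^ 2 := by
    have hs : 0 ≤ ∑ i, (B.mulVec y) i ^ 2 := Finset.sum_nonneg fun i _ => sq_nonneg _
    rw [← Real.sq_sqrt hs]
    refine pow_le_pow_left₀ (norm_nonneg _) ((pi_norm_le_iff_of_nonneg (Real.sqrt_nonneg _)).2
      fun i => Real.le_sqrt_of_sq_le ?_) 2
    rw [Real.norm_eq_abs, sq_abs]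
    exact Finset.single_le_sum (f := fun i => (B.mulVec y) i ^ 2) (fun i _ => sq_nonneg _)
      (Finset.mem_univ i)
  have h3 : ‖y‖ ^ 2 ≤ C ^ 2 * ∑ i, (B.mulVec y) i ^ 2 := by
    calc ‖y‖ ^ 2 ≤ (C * ‖B.mulVec y‖) ^ 2 := pow_le_pow_left₀ (norm_nonneg _) h1 2
      _ = C ^ 2 * ‖B.mulVec y‖ ^ 2 := by ring
      _ ≤ _ := by gcongr
  rw [halfSq, div_mul_eq_mul_div, one_mul, div_le_iff₀ (by positivity)]
  linarith

/-- The volume of the ellipsoid `½ |B y|² ≤ 1`. -/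
noncomputable def ellipsoidVolume (B : Matrix (Fin d) (Fin d) ℝ) : ℝ :=
  |B.det|⁻¹ * (√2 ^ d * (√Real.pi ^ d / Real.Gamma (d / 2 + 1)))

lemma ellipsoidVolume_nonneg (B : Matrix (Fin d) (Fin d) ℝ) : 0 ≤ ellipsoidVolume B := by
  have : 0 < Real.Gamma ((d : ℝ) / 2 + 1) := Real.Gamma_pos_of_pos (by positivity)
  unfold ellipsoidVolume
  positivity

/-- The set is a translate of the preimage under `B` of the Euclidean ball of radius `√2 s`. -/
lemma volume_real_halfSq_le (hd : 1 ≤ d) {B : Matrix (Fin d) (Fin d) ℝ} (hB : B.det ≠ 0)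
    (v : Fin d → ℝ) {s : ℝ} (hs : 0 ≤ s) :
    volume.real {x | halfSq B (x - v) ≤ s ^ 2} = ellipsoidVolume B * s ^ d := by
  have : Nonempty (Fin d) := ⟨⟨0, hd⟩⟩
  have hdet : LinearMap.det (Matrix.toLin' B) ≠ 0 := by rwa [LinearMap.det_toLin']
  have h1 : {x | halfSq B (x - v) ≤ s ^ 2} = (fun x => x + -v) ⁻¹' ((Matrix.toLin' B) ⁻¹'
      ((WithLp.toLp 2 : (Fin d → ℝ) → EuclideanSpace ℝ (Fin d)) ⁻¹'
        Metric.closedBall 0 (√2 * s))) := by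
    ext x
    simp only [mem_ofPred_eq, mem_preimage, mem_closedBall_zero_iff, Matrix.toLin'_apply, halfSq,
      EuclideanSpace.norm_eq, Real.norm_eq_abs, sq_abs, ← sub_eq_add_neg]
    rw [Real.sqrt_le_left (by positivity), mul_pow, Real.sq_sqrt (by norm_num)]
    constructor <;> intro h <;> linarith
  have hΓ : 0 < Real.Gamma ((d : ℝ) / 2 + 1) := Real.Gamma_pos_of_pos (by positivity)
  rw [measureReal_def, h1, measure_preimage_add_right, Measure.addHaar_preimage_linearMap _ hdet,
    (PiLp.volume_preserving_toLp (Fin d)).measure_preimage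
      Metric.isClosed_closedBall.measurableSet.nullMeasurableSet,
    EuclideanSpace.volume_closedBall, Fintype.card_fin, LinearMap.det_toLin',
    ← ENNReal.ofReal_pow (by positivity), ← ENNReal.ofReal_mul (by positivity),
    ← ENNReal.ofReal_mul (by positivity), ENNReal.toReal_ofReal (by positivity), ellipsoidVolume,
    abs_inv, mul_pow]
  ring

end Quadratic

/-! ### Quadratic behaviour of the kernel at a maximum. -/

section LocalStructure

variable {d : ℕ} {f : (Fin (d + 1) → Circle) → EReal} {h : (Fin d → ℝ) → EReal} {M : ℝ}
  {V : Finset (Fin d → ℝ)}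

lemma bilin_apply_eq_dotProduct (D : (Fin d → ℝ) →L[ℝ] (Fin d → ℝ) →L[ℝ] ℝ) (y : Fin d → ℝ) :
    D y y = y ⬝ᵥ (Matrix.of fun i j => D (Pi.single i 1) (Pi.single j 1)).mulVec y := by
  have hy : y = ∑ i, y i • (Pi.single i 1 : Fin d → ℝ) := pi_eq_sum_univ' y
  conv_lhs => rw [hy]
  simp only [map_sum, map_smul, sum_apply, smul_apply, smul_eq_mul,
    dotProduct, Matrix.mulVec, Matrix.of_apply, Finset.mul_sum]
  rw [Finset.sum_comm]
  refine Finset.sum_congr rfl fun i _ => Finset.sum_congr rfl fun j _ => ?_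
  ring

lemma hessian_eq {v : Fin d → ℝ} (hg : ContDiffAt ℝ 3 (fun x => (h x).toReal) v) :
    hessian h v = Matrix.of fun i j =>
      fderiv ℝ (fderiv ℝ fun x => (h x).toReal) v (Pi.single i 1) (Pi.single j 1) := by
  ext i j
  have h1 : ContDiffAt ℝ 2 (fderiv ℝ fun x => (h x).toReal) v := hg.fderiv_right (by norm_num)
  have h2 := (h1.differentiableAt (by norm_num)).hasFDerivAt.clm_apply
    (hasFDerivAt_const (Pi.single j 1 : Fin d → ℝ) v)
  simp only [hessian, Matrix.of_apply]
  rw [h2.fderiv]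
  simp

lemma KernelConditions.le_max (hf : KernelConditions f h M V) {x : Fin d → ℝ}
    (hx : x ∈ angleCube d) : h x ≤ M :=
  hf.max_value.2 (mem_image_of_mem h hx)

lemma KernelConditions.apply_eq_coe (hf : KernelConditions f h M V) {x : Fin d → ℝ}
    (hx : x ∈ angleCube d) (hbot : h x ≠ ⊥) : ((h x).toReal : EReal) = h x :=
  EReal.coe_toReal (ne_top_of_le_ne_top (EReal.coe_ne_top M) (hf.le_max hx)) hbot

/-- Near a point of maximum, `M - h` is a positive definite quadratic form up to a cubic
remainder. -/
theorem KernelConditions.exists_quadratic_approximation (hf : KernelConditions f h M V)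
    {v : Fin d → ℝ} (hv : v ∈ V) :
    ∃ B : Matrix (Fin d) (Fin d) ℝ, B.det ≠ 0 ∧ (-hessian h v).det = B.det ^ 2 ∧
      ∃ L : ℝ, 0 ≤ L ∧ ∃ r > 0, ∀ x ∈ Metric.ball v r,
        |M - (h x).toReal - halfSq B (x - v)| ≤ L * ‖x - v‖ ^ 3 := by
  obtain ⟨δ, hδ, hsm⟩ := hf.smooth
  obtain ⟨hcube, hbot, hC3⟩ := hsm v hv
  set g : (Fin d → ℝ) → ℝ := fun x => (h x).toReal with hg
  have hgv : ContDiffAt ℝ 3 g v := hC3.contDiffAt (Metric.ball_mem_nhds v hδ)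
  have hgM : g v = M := by simp [hg, ((hf.max_points v).1 hv).2]
  have hle : ∀ x ∈ Metric.ball v δ, g x ≤ g v := by
    intro x hx
    have := hf.le_max (hcube hx)
    rw [← hf.apply_eq_coe (hcube hx) (hbot x hx), EReal.coe_le_coe_iff] at this
    rwa [hgM]
  have hlocmax : IsLocalMax g v := by
    filter_upwards [Metric.ball_mem_nhds v hδ] with x hx using hle x hx
  obtain ⟨L, hL, r, hr, htaylor⟩ := exists_abs_sub_taylor_two_le hgv hlocmax.fderiv_eq_zero
  have hD : ∀ y, fderiv ℝ (fderiv ℝ g) v y y ≤ 0 :=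
    second_fderiv_apply_nonpos (lt_min hr hδ)
      (fun x hx => htaylor x (Metric.ball_subset_ball (min_le_left _ _) hx))
      (fun x hx => hle x (Metric.ball_subset_ball (min_le_right _ _) hx))
  have hDH : ∀ y, fderiv ℝ (fderiv ℝ g) v y y = y ⬝ᵥ (hessian h v).mulVec y := fun y => by
    rw [hessian_eq hgv, bilin_apply_eq_dotProduct]
  have hpsd : (-hessian h v).PosSemidef := by
    refine Matrix.PosSemidef.of_dotProduct_mulVec_nonneg ?_ fun y => ?_
    · refine Matrix.IsHermitian.neg ?_
      rw [hessian_eq hgv]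
      ext i j
      have := hgv.isSymmSndFDerivAt (by rw [minSmoothness_of_isRCLikeNormedField]; norm_num)
      simpa using this.eq _ _
    · rw [star_trivial, Matrix.neg_mulVec, dotProduct_neg, ← hDH]
      linarith [hD y]
  obtain ⟨B, hB⟩ := exists_eq_transpose_mul_self hpsd
  have hdet : (-hessian h v).det = B.det ^ 2 := by
    rw [hB, Matrix.det_mul, Matrix.det_transpose, sq]
  refine ⟨B, ?_, hdet, L, hL, r, hr, fun x hx => ?_⟩
  · intro h0
    rw [h0, Matrix.det_neg] at hdet
    simp [hf.hessian_nondegenerate v hv] at hdet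
  · have h1 := htaylor x hx
    have h2 : halfSq B (x - v) = -(1 / 2 * fderiv ℝ (fderiv ℝ g) v (x - v) (x - v)) := by
      rw [halfSq_eq_dotProduct, ← hB, hDH, Matrix.neg_mulVec, dotProduct_neg]
      ring
    rw [h2, ← hgM, ← abs_neg]
    convert h1 using 2
    ring

end LocalStructure

end UMax

namespace UMax

/-! ### Asymptotics of the exceedance probability -/

section LocalVolume

variable {d : ℕ}

lemma one_add_pow_le_of_le_one {x : ℝ} (h0 : 0 ≤ x) (h1 : x ≤ 1) (n : ℕ) :
    (1 + x) ^ n ≤ 1 + 2 ^ n * x := by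
  -- The factor `2 ^ n - 1` is what the induction reproduces.
  suffices (1 + x) ^ n ≤ 1 + (2 ^ n - 1) * x by linarith
  induction n with
  | zero => simp
  | succ n ih =>
    have h2 : (1 : ℝ) ≤ 2 ^ n := one_le_pow₀ (by norm_num)
    calc (1 + x) ^ (n + 1) = (1 + x) ^ n * (1 + x) := pow_succ _ _
      _ ≤ (1 + (2 ^ n - 1) * x) * (1 + x) := by gcongr
      _ ≤ 1 + (2 ^ (n + 1) - 1) * x := by
        rw [pow_succ]
        nlinarith [mul_nonneg (sub_nonneg.2 h2) (mul_nonneg h0 (sub_nonneg.2 h1))]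

lemma one_sub_mul_le_pow {x : ℝ} (h0 : 0 ≤ x) (h1 : x ≤ 1) (n : ℕ) :
    1 - 2 ^ n * x ≤ (1 - x) ^ n := by
  have h2 := one_add_mul_le_pow (a := -x) (by linarith) n
  have h3 : (n : ℝ) ≤ 2 ^ n := by exact_mod_cast Nat.lt_two_pow_self.le
  rw [← sub_eq_add_neg] at h2
  nlinarith

/-- The volume of `{φ ≤ η²}` near a point where `φ` is a positive definite quadratic form up to a
cubic remainder. -/
lemma exists_volume_sublevel_bound (hd : 1 ≤ d) {φ : (Fin d → ℝ) → ℝ} {v : Fin d → ℝ}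
    {B : Matrix (Fin d) (Fin d) ℝ} (hB : B.det ≠ 0) {L r : ℝ} (hL : 0 ≤ L) (hr : 0 < r)
    (hφ : ∀ x ∈ Metric.ball v r, |φ x - halfSq B (x - v)| ≤ L * ‖x - v‖ ^ 3) :
    ∃ R > 0, ∀ r₀, 0 < r₀ → r₀ ≤ R → ∃ C, 0 ≤ C ∧ ∀ᶠ η in 𝓝[>] (0 : ℝ),
      {x | x ∈ Metric.ball v r₀ ∧ φ x ≤ η ^ 2} ⊆ Metric.ball v (C * η) ∧
      |volume.real {x | x ∈ Metric.ball v r₀ ∧ φ x ≤ η ^ 2} - ellipsoidVolume B * η ^ d| ≤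
        C * η ^ (d + 1) := by
  obtain ⟨c, hc, hcB⟩ := exists_mul_norm_sq_le_halfSq hB
  -- Within this radius the cubic remainder is at most half of the lower bound `c ‖y‖²`; `L + 1`
  -- avoids division by zero. Every smaller `r₀` is admitted so that one radius can later serve all
  -- maxima.
  refine ⟨min r (c / (2 * (L + 1))), by positivity, fun r₀ hr₀ hr₀R => ?_⟩
  have hr₀r : r₀ ≤ r := hr₀R.trans (min_le_left _ _)
  have hLr₀ : L * r₀ ≤ c / 2 := by
    have h1 : r₀ ≤ c / (2 * (L + 1)) := hr₀R.trans (min_le_right _ _)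
    rw [le_div_iff₀ (by positivity)] at h1
    nlinarith
  set C₁ := √(2 / c) with hC₁
  have hC₁0 : 0 ≤ C₁ := Real.sqrt_nonneg _
  have hC₁sq : c * C₁ ^ 2 = 2 := by
    rw [hC₁, Real.sq_sqrt (by positivity)]
    field_simp
  set C₂ := L * C₁ ^ 3 with hC₂
  have hC₂0 : 0 ≤ C₂ := by positivity
  have hκ := ellipsoidVolume_nonneg B
  -- `C₁ η` bounds the distance to `v` on the sublevel set and `C₂ η³` the remainder there. The `1`
  -- makes the inclusion in the open ball strict; the last summand is the volume error.
  refine ⟨C₁ + 1 + ellipsoidVolume B * 2 ^ d * C₂, by positivity, ?_⟩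
  have hev₁ : ∀ᶠ η in 𝓝[>] (0 : ℝ), C₂ * η < 1 := by
    have : Tendsto (fun η => C₂ * η) (𝓝 0) (𝓝 (C₂ * 0)) := Continuous.tendsto (by fun_prop) 0
    rw [mul_zero] at this
    exact nhdsWithin_le_nhds (this.eventually (eventually_lt_nhds one_pos))
  have hev₂ : ∀ᶠ η in 𝓝[>] (0 : ℝ), C₁ * η < r₀ := by
    have : Tendsto (fun η => C₁ * η) (𝓝 0) (𝓝 (C₁ * 0)) := Continuous.tendsto (by fun_prop) 0
    rw [mul_zero] at this
    exact nhdsWithin_le_nhds (this.eventually (eventually_lt_nhds hr₀))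
  filter_upwards [hev₁, hev₂, self_mem_nhdsWithin] with η hη₁ hη₂ hη
  have hη0 : 0 < η := hη
  have hnorm : ∀ y : Fin d → ℝ, c / 2 * ‖y‖ ^ 2 ≤ η ^ 2 → ‖y‖ ≤ C₁ * η := by
    intro y hy
    refine le_of_sq_le_sq ?_ (by positivity)
    have : c * ‖y‖ ^ 2 ≤ c * (C₁ * η) ^ 2 := by
      rw [mul_pow, ← mul_assoc, hC₁sq]
      linarith
    exact le_of_mul_le_mul_left this hc
  have hcube : ∀ y : Fin d → ℝ, ‖y‖ ≤ C₁ * η → L * ‖y‖ ^ 3 ≤ C₂ * η ^ 3 := by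
    intro y hy
    calc L * ‖y‖ ^ 3 ≤ L * (C₁ * η) ^ 3 := by gcongr
      _ = C₂ * η ^ 3 := by rw [hC₂]; ring
  set S := {x | x ∈ Metric.ball v r₀ ∧ φ x ≤ η ^ 2} with hS
  have hin : ∀ x ∈ S, ‖x - v‖ ≤ C₁ * η := by
    rintro x ⟨hx, hφx⟩
    have hxr : ‖x - v‖ < r₀ := by rwa [Metric.mem_ball, dist_eq_norm] at hx
    have h1 := (abs_le.1 (hφ x (Metric.ball_subset_ball hr₀r hx))).1
    have h2 := hcB (x - v)
    have h3 : L * ‖x - v‖ ^ 3 ≤ c / 2 * ‖x - v‖ ^ 2 := by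
      calc L * ‖x - v‖ ^ 3 = (L * ‖x - v‖) * ‖x - v‖ ^ 2 := by ring
        _ ≤ (L * r₀) * ‖x - v‖ ^ 2 := by gcongr
        _ ≤ _ := by gcongr
    refine hnorm _ ?_
    linarith
  -- The sublevel set is squeezed between the ellipsoids of scale `η (1 ± C₂ η)`.
  have hupper : S ⊆ {x | halfSq B (x - v) ≤ (η * (1 + C₂ * η)) ^ 2} := by
    intro x hx
    have h1 := (abs_le.1 (hφ x (Metric.ball_subset_ball hr₀r hx.1))).1
    have h2 := hcube _ (hin x hx)
    have h3 := hx.2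
    have h4 : η ^ 2 + C₂ * η ^ 3 ≤ (η * (1 + C₂ * η)) ^ 2 := by
      have : 0 ≤ C₂ * η ^ 3 + (C₂ * η ^ 2) ^ 2 := by positivity
      linarith
    rw [mem_ofPred_eq]
    linarith
  have hlower : {x | halfSq B (x - v) ≤ (η * (1 - C₂ * η)) ^ 2} ⊆ S := by
    intro x hx
    rw [mem_ofPred_eq] at hx
    have hx1 : 0 ≤ C₂ * η := by positivity
    have h0 : (η * (1 - C₂ * η)) ^ 2 + C₂ * η ^ 3 ≤ η ^ 2 := by
      have : 0 ≤ η ^ 2 * (C₂ * η * (1 - C₂ * η)) :=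
        mul_nonneg (sq_nonneg _) (mul_nonneg hx1 (by linarith))
      linarith
    have h0' : 0 ≤ C₂ * η ^ 3 := by positivity
    have h1 : ‖x - v‖ ≤ C₁ * η := by
      refine hnorm _ ?_
      have h2 := hcB (x - v)
      have h3 : c / 2 * ‖x - v‖ ^ 2 ≤ c * ‖x - v‖ ^ 2 := by gcongr; linarith
      linarith
    have hxb : x ∈ Metric.ball v r₀ := by
      rw [Metric.mem_ball, dist_eq_norm]
      exact h1.trans_lt hη₂
    refine ⟨hxb, ?_⟩
    have h2 := (abs_le.1 (hφ x (Metric.ball_subset_ball hr₀r hxb))).2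
    have h3 := hcube _ h1
    linarith
  have hfin : ∀ s : ℝ, volume {x | halfSq B (x - v) ≤ s} ≠ ⊤ := by
    intro s
    refine ((measure_mono fun x hx => ?_).trans_lt
      (measure_closedBall_lt_top (x := v) (r := √(s / c)))).ne
    rw [mem_ofPred_eq] at hx
    rw [Metric.mem_closedBall, dist_eq_norm]
    refine Real.le_sqrt_of_sq_le ?_
    rw [le_div_iff₀ hc]
    linarith [hcB (x - v)]
  have hSfin : volume S ≠ ⊤ := ((measure_mono hupper).trans_lt (hfin _).lt_top).ne
  have hv₁ := measureReal_mono hupper (hfin _)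
  have hv₂ := measureReal_mono hlower hSfin
  rw [volume_real_halfSq_le hd hB v (by positivity), mul_pow] at hv₁
  rw [volume_real_halfSq_le hd hB v (mul_nonneg hη0.le (by linarith)), mul_pow] at hv₂
  have hp₁ := one_add_pow_le_of_le_one (x := C₂ * η) (by positivity) hη₁.le d
  have hp₂ := one_sub_mul_le_pow (x := C₂ * η) (by positivity) hη₁.le d
  have hκη : 0 ≤ ellipsoidVolume B * η ^ d := by positivity
  have hq₁ := mul_le_mul_of_nonneg_left hp₁ hκη
  have hq₂ := mul_le_mul_of_nonneg_left hp₂ hκη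
  constructor
  · intro x hx
    rw [Metric.mem_ball, dist_eq_norm]
    refine (hin x hx).trans_lt ?_
    have : 0 ≤ ellipsoidVolume B * 2 ^ d * C₂ := by positivity
    nlinarith
  · have h1 : 0 ≤ (C₁ + 1) * η ^ (d + 1) := by positivity
    have h2 : (C₁ + 1 + ellipsoidVolume B * 2 ^ d * C₂) * η ^ (d + 1) =
        (C₁ + 1) * η ^ (d + 1) + ellipsoidVolume B * η ^ d * (2 ^ d * (C₂ * η)) := by ring
    rw [h2, abs_le]
    constructor <;> linarith

end LocalVolume

/-! ### From local volumes to the probability of one exceedance. -/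

section Global

variable {d : ℕ} {f : (Fin (d + 1) → Circle) → EReal} {h : (Fin d → ℝ) → EReal} {M : ℝ}
  {V : Finset (Fin d → ℝ)}

lemma pi_uniformAngle (d : ℕ) : (Measure.pi fun _ : Fin d => uniformAngle) =
    (ENNReal.ofReal (1 / (2 * Real.pi))) ^ d •
      volume.restrict (Set.pi univ fun _ : Fin d => Ico (0 : ℝ) (2 * Real.pi)) := by
  refine Measure.pi_eq fun s hs => ?_
  rw [Measure.smul_apply, Measure.restrict_apply (MeasurableSet.univ_pi hs), ← Set.pi_inter_distrib,
    volume_pi_pi, smul_eq_mul]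
  simp only [uniformAngle, Measure.smul_apply, smul_eq_mul, Measure.restrict_apply (hs _),
    Finset.prod_mul_distrib, Finset.prod_const, Finset.card_univ, Fintype.card_fin]

lemma measureReal_pi_uniformAngle {S : Set (Fin d → ℝ)} (hS : MeasurableSet S)
    (hsub : ∀ x ∈ S, ∀ j, x j ∈ Ico (0 : ℝ) (2 * Real.pi)) :
    (Measure.pi fun _ : Fin d => uniformAngle).real S =
      (1 / (2 * Real.pi)) ^ d * volume.real S := by
  have h1 : S ∩ Set.pi univ (fun _ : Fin d => Ico (0 : ℝ) (2 * Real.pi)) = S :=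
    inter_eq_left.2 fun x hx j _ => hsub x hx j
  rw [measureReal_def, pi_uniformAngle, Measure.smul_apply, Measure.restrict_apply hS, h1,
    smul_eq_mul, ENNReal.toReal_mul, ENNReal.toReal_pow, ENNReal.toReal_ofReal (by positivity)]
  rfl

/-- Away from the balls `h` attains, by compactness, a maximum strictly below `M`. As that maximum
may be `-∞`, a real number is inserted between it and `M`. -/
lemma KernelConditions.eventually_superlevel_subset (hf : KernelConditions f h M V) {r : ℝ}
    (hr : 0 < r) :
    ∀ᶠ η in 𝓝[>] (0 : ℝ),
      superlevel h ((M - η ^ 2 : ℝ) : EReal) ⊆ ⋃ v ∈ V, Metric.ball v r := by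
  set K := angleCube d \ ⋃ v ∈ V, Metric.ball v r with hK
  have hKc : IsCompact K := (isCompact_angleCube d).diff
    (isOpen_biUnion fun v _ => Metric.isOpen_ball)
  obtain ⟨a, haM, ha⟩ : ∃ a : ℝ, a < M ∧ ∀ x ∈ K, h x < a := by
    rcases K.eq_empty_or_nonempty with hKe | hKne
    · exact ⟨M - 1, by linarith, by simp [hKe]⟩
    · obtain ⟨x₀, hx₀, hmax⟩ := hKc.exists_isMaxOn hKne (hf.continuousOn.mono sdiff_subset)
      have hlt : h x₀ < M := by
        refine lt_of_le_of_ne (hf.le_max hx₀.1) fun heq => hx₀.2 ?_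
        exact mem_iUnion₂.2 ⟨x₀, (hf.max_points x₀).2 ⟨hx₀.1, heq⟩, Metric.mem_ball_self hr⟩
      obtain ⟨a, ha1, ha2⟩ := EReal.lt_iff_exists_real_btwn.1 hlt
      exact ⟨a, EReal.coe_lt_coe_iff.1 ha2, fun x hx => (hmax hx).trans_lt ha1⟩
  have hlim : Tendsto (fun η : ℝ => M - η ^ 2) (𝓝 0) (𝓝 (M - 0 ^ 2)) :=
    Continuous.tendsto (by fun_prop) 0
  simp only [ne_eq, OfNat.ofNat_ne_zero, not_false_eq_true, zero_pow, sub_zero] at hlim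
  filter_upwards [nhdsWithin_le_nhds (hlim.eventually (eventually_gt_nhds haM))] with η hη x hx
  by_contra hcon
  have h1 := ha x ⟨hx.1, hcon⟩
  have h2 := hx.2.trans_lt h1
  rw [EReal.coe_lt_coe_iff] at h2
  linarith

/-- The superlevel sets shrink to the points of maximum, and the exceedance probability has the
expected order. -/
theorem KernelConditions.exists_exceedanceProb_bound (hf : KernelConditions f h M V)
    (hd : 1 ≤ d) :
    ∃ C, 0 ≤ C ∧ ∀ᶠ η in 𝓝[>] (0 : ℝ),
      superlevel h ((M - η ^ 2 : ℝ) : EReal) ⊆ ⋃ v ∈ V, Metric.ball v (C * η) ∧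
      |exceedanceProb h ((M - η ^ 2 : ℝ) : EReal) - uniformConst h V * η ^ d| ≤
        C * η ^ (d + 1) := by
  set κ : (Fin d → ℝ) → ℝ := fun v =>
    √2 ^ d * (√Real.pi ^ d / Real.Gamma (d / 2 + 1)) * (1 / √(-hessian h v).det) with hκ
  obtain ⟨δ, hδ, hsm⟩ := hf.smooth
  have hloc : ∀ v ∈ V, ∃ R > 0, ∀ r₀, 0 < r₀ → r₀ ≤ R → ∃ C, 0 ≤ C ∧ ∀ᶠ η in 𝓝[>] (0 : ℝ),
      {x | x ∈ Metric.ball v r₀ ∧ M - (h x).toReal ≤ η ^ 2} ⊆ Metric.ball v (C * η) ∧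
      |volume.real {x | x ∈ Metric.ball v r₀ ∧ M - (h x).toReal ≤ η ^ 2} - κ v * η ^ d| ≤
        C * η ^ (d + 1) := by
    intro v hv
    obtain ⟨B, hB, hdet, L, hL, r, hr, hφ⟩ := hf.exists_quadratic_approximation hv
    have hκv : κ v = ellipsoidVolume B := by
      simp only [hκ, hdet, Real.sqrt_sq_eq_abs, ellipsoidVolume, one_div]
      ring
    rw [hκv]
    exact exists_volume_sublevel_bound hd hB hL hr hφ
  have hR : ∀ᶠ r₀ in 𝓝[>] (0 : ℝ), ∀ v ∈ V, ∃ C, 0 ≤ C ∧ ∀ᶠ η in 𝓝[>] (0 : ℝ),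
      {x | x ∈ Metric.ball v r₀ ∧ M - (h x).toReal ≤ η ^ 2} ⊆ Metric.ball v (C * η) ∧
      |volume.real {x | x ∈ Metric.ball v r₀ ∧ M - (h x).toReal ≤ η ^ 2} - κ v * η ^ d| ≤
        C * η ^ (d + 1) := by
    rw [Finset.eventually_all]
    intro v hv
    obtain ⟨R, hR0, hR⟩ := hloc v hv
    filter_upwards [Ioc_mem_nhdsGT hR0] with r₀ hr₀ using hR r₀ hr₀.1 hr₀.2
  have hdisj : ∀ᶠ r₀ in 𝓝[>] (0 : ℝ), ∀ v ∈ V, ∀ w ∈ V, v ≠ w →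
      Disjoint (Metric.ball v r₀) (Metric.ball w r₀) := by
    rw [Finset.eventually_all]
    intro v _
    rw [Finset.eventually_all]
    intro w _
    by_cases hvw : v = w
    · simp [hvw]
    · have hpos : 0 < dist v w / 2 := by
        have := dist_pos.2 hvw
        positivity
      filter_upwards [Ioc_mem_nhdsGT hpos] with r₀ hr₀ _
      exact Metric.ball_disjoint_ball (by linarith [hr₀.2])
  have hcube : ∀ᶠ r₀ in 𝓝[>] (0 : ℝ), ∀ v ∈ V, ∀ x ∈ Metric.ball v r₀,
      ∀ j, x j ∈ Ico (0 : ℝ) (2 * Real.pi) := by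
    rw [Finset.eventually_all]
    intro v hv
    have hopen : IsOpen (Set.pi univ fun _ : Fin d => Ioo (0 : ℝ) (2 * Real.pi)) :=
      isOpen_set_pi finite_univ fun _ _ => isOpen_Ioo
    obtain ⟨ρ, hρ, hρsub⟩ := Metric.isOpen_iff.1 hopen v
      fun j _ => hf.max_points_interior v hv j
    filter_upwards [Ioc_mem_nhdsGT hρ] with r₀ hr₀ x hx j
    exact Ioo_subset_Ico_self (hρsub (Metric.ball_subset_ball hr₀.2 hx) j (mem_univ j))
  -- One radius gives the local estimates, disjoint balls (so volumes add) and balls inside the open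
  -- cube (so the uniform density applies).
  obtain ⟨r₀, hr₀C, hr₀d, hr₀c, hr₀0, hr₀δ⟩ :=
    (hR.and (hdisj.and (hcube.and (Ioc_mem_nhdsGT hδ)))).exists
  choose! C hC0 hC using hr₀C
  have hCsum : ∀ v ∈ V, C v ≤ ∑ v ∈ V, C v := fun v hv =>
    Finset.single_le_sum (f := C) (fun w hw => hC0 w hw) hv
  have hCs0 : 0 ≤ ∑ v ∈ V, C v := Finset.sum_nonneg hC0
  refine ⟨∑ v ∈ V, C v, hCs0, ?_⟩
  filter_upwards [(Finset.eventually_all V).2 hC, hf.eventually_superlevel_subset hr₀0,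
    self_mem_nhdsWithin] with η hη hsub hη0
  have hη0' : 0 < η := hη0
  set S := superlevel h ((M - η ^ 2 : ℝ) : EReal) with hS
  have hSm : MeasurableSet S := (hf.isClosed_superlevel _).measurableSet
  have hpart : ∀ v ∈ V, S ∩ Metric.ball v r₀ =
      {x | x ∈ Metric.ball v r₀ ∧ M - (h x).toReal ≤ η ^ 2} := by
    intro v hv
    ext x
    simp only [mem_inter_iff, mem_ofPred_eq]
    rw [and_comm]
    refine and_congr_right fun hx => ?_
    obtain ⟨h1, h2, -⟩ := hsm v hv
    have hxδ := Metric.ball_subset_ball hr₀δ hx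
    have h3 : ((M - η ^ 2 : ℝ) : EReal) ≤ h x ↔ M - (h x).toReal ≤ η ^ 2 := by
      rw [← hf.apply_eq_coe (h1 hxδ) (h2 x hxδ), EReal.coe_le_coe_iff, EReal.toReal_coe]
      constructor <;> intro h4 <;> linarith
    rw [← h3]
    exact ⟨fun h4 => h4.2, fun h4 => ⟨h1 hxδ, h4⟩⟩
  have hunion : S = ⋃ v ∈ V, S ∩ Metric.ball v r₀ := by
    rw [← inter_iUnion₂]
    exact (inter_eq_left.2 hsub).symm
  constructor
  · rw [hunion]
    refine iUnion₂_mono fun v hv => ?_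
    rw [hpart v hv]
    refine (hη v hv).1.trans (Metric.ball_subset_ball ?_)
    exact mul_le_mul_of_nonneg_right (hCsum v hv) hη0'.le
  · have hSIco : ∀ x ∈ S, ∀ j, x j ∈ Ico (0 : ℝ) (2 * Real.pi) := by
      intro x hx
      obtain ⟨v, hv, hxv⟩ := mem_iUnion₂.1 (hsub hx)
      exact hr₀c v hv x hxv
    have hvol : volume.real S = ∑ v ∈ V, volume.real (S ∩ Metric.ball v r₀) := by
      conv_lhs => rw [hunion]
      refine measureReal_biUnion_finset (fun v hv w hw hvw => ?_)
        (fun v _ => hSm.inter measurableSet_ball) (fun v _ => ?_)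
      · exact (hr₀d v hv w hw hvw).mono inter_subset_right inter_subset_right
      · exact ((measure_mono inter_subset_right).trans_lt measure_ball_lt_top).ne
    -- The factor `(2π)^(d/2)` from the ellipsoid volumes cancels half of the density `(2π)⁻ᵈ`.
    have hK : uniformConst h V = (1 / (2 * Real.pi)) ^ d * ∑ v ∈ V, κ v := by
      have h1 : (2 * Real.pi) ^ ((d : ℝ) / 2) = √2 ^ d * √Real.pi ^ d := by
        rw [div_eq_inv_mul, Real.rpow_mul (by positivity), Real.rpow_natCast, ← mul_pow,
          ← Real.sqrt_mul (by norm_num), Real.sqrt_eq_rpow, one_div]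
      have h2 : (2 * Real.pi) ^ d = (√2 ^ d * √Real.pi ^ d) * (√2 ^ d * √Real.pi ^ d) := by
        rw [← mul_pow, ← mul_pow]
        congr 1
        rw [mul_mul_mul_comm, Real.mul_self_sqrt (by norm_num),
          Real.mul_self_sqrt Real.pi_pos.le]
      have h3 : ((d : ℝ) + 2) / 2 = d / 2 + 1 := by ring
      have h4 : Real.Gamma ((d : ℝ) / 2 + 1) ≠ 0 := (Real.Gamma_pos_of_pos (by positivity)).ne'
      have h5 : √2 ^ d * √Real.pi ^ d ≠ 0 := by positivity
      simp only [uniformConst, hκ]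
      rw [← Finset.mul_sum, h3, h1, ← mul_assoc, one_div_pow, h2]
      congr 1
      field_simp
    have hpi : (1 / (2 * Real.pi)) ^ d ≤ 1 := by
      refine pow_le_one₀ (by positivity) ?_
      rw [div_le_one Real.two_pi_pos]
      linarith [Real.pi_gt_three]
    have hpi0 : 0 ≤ (1 / (2 * Real.pi)) ^ d := by positivity
    rw [exceedanceProb, measureReal_pi_uniformAngle hSm hSIco, hvol, hK, mul_assoc,
      Finset.sum_mul, ← mul_sub, ← Finset.sum_sub_distrib, abs_mul, abs_of_nonneg hpi0]
    refine (mul_le_of_le_one_left (abs_nonneg _) hpi).trans ?_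
    rw [Finset.sum_mul]
    refine (Finset.abs_sum_le_sum_abs _ _).trans (Finset.sum_le_sum fun v hv => ?_)
    rw [hpart v hv]
    exact (hη v hv).2

end Global

end UMax

namespace UMax

/-! ### The limit theorem -/

section Elementary

lemma abs_exp_neg_sub_exp_neg_le {a b : ℝ} (ha : 0 ≤ a) (hb : 0 ≤ b) :
    |Real.exp (-a) - Real.exp (-b)| ≤ |a - b| := by
  wlog hab : a ≤ b generalizing a b
  · rw [abs_sub_comm, abs_sub_comm a b]
    exact this hb ha (not_le.1 hab).le
  have h1 : Real.exp (-b) = Real.exp (-a) * Real.exp (-(b - a)) := by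
    rw [← Real.exp_add]
    ring_nf
  have h2 := Real.add_one_le_exp (-(b - a))
  have h3 : Real.exp (-a) ≤ 1 := Real.exp_le_one_iff.2 (by linarith)
  have h4 : Real.exp (-(b - a)) ≤ 1 := Real.exp_le_one_iff.2 (by linarith)
  have h5 : Real.exp (-a) - Real.exp (-b) = Real.exp (-a) * (1 - Real.exp (-(b - a))) := by
    rw [h1]
    ring
  rw [h5, abs_of_nonneg (mul_nonneg (Real.exp_pos _).le (by linarith)), abs_sub_comm,
    abs_of_nonneg (sub_nonneg.2 hab)]
  calc Real.exp (-a) * (1 - Real.exp (-(b - a))) ≤ 1 * (1 - Real.exp (-(b - a))) := by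
        gcongr
    _ ≤ b - a := by linarith

/-- The falling factorial lies between `(n - d) ^ (d+1)` and `n ^ (d+1)`; Bernoulli's inequality
bounds the gap. -/
lemma abs_choose_div_pow_sub_le {d n : ℕ} (hn : d + 1 ≤ n) :
    |(n.choose (d + 1) : ℝ) / (n : ℝ) ^ (d + 1) - 1 / ((d + 1).factorial : ℝ)| ≤
      (d + 1) * d * (n : ℝ)⁻¹ := by
  have hn0 : (0 : ℝ) < n := by exact_mod_cast (by omega : 0 < n)
  have hfac : (1 : ℝ) ≤ (d + 1).factorial := by exact_mod_cast Nat.factorial_pos (d + 1)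
  have hchoose : (n.choose (d + 1) : ℝ) = n.descFactorial (d + 1) / (d + 1).factorial := by
    rw [Nat.descFactorial_eq_factorial_mul_choose]
    push_cast
    field_simp
  have hup : (n.descFactorial (d + 1) : ℝ) ≤ (n : ℝ) ^ (d + 1) := by
    exact_mod_cast Nat.descFactorial_le_pow n (d + 1)
  have hlow : (n : ℝ) ^ (d + 1) * (1 - (d + 1) * d * (n : ℝ)⁻¹) ≤ n.descFactorial (d + 1) := by
    have h1 : ((n : ℝ) - d) ^ (d + 1) ≤ n.descFactorial (d + 1) := by
      have := Nat.pow_sub_le_descFactorial n (d + 1)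
      rw [show n + 1 - (d + 1) = n - d by omega] at this
      rw [← Nat.cast_sub (by omega)]
      exact_mod_cast this
    have h2 : (n : ℝ) - d = n * (1 - d * (n : ℝ)⁻¹) := by field_simp
    have h3 : (d : ℝ) * (n : ℝ)⁻¹ ≤ 1 := by
      rw [← div_eq_mul_inv, div_le_one hn0]
      exact_mod_cast (by omega : d ≤ n)
    have h4 := one_add_mul_le_pow (a := -(d * (n : ℝ)⁻¹)) (by linarith) (d + 1)
    rw [h2, mul_pow] at h1
    refine le_trans ?_ h1
    gcongr
    refine le_trans (le_of_eq ?_) h4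
    push_cast
    ring
  have hpow : (0 : ℝ) < (n : ℝ) ^ (d + 1) := by positivity
  have h1 : (n.choose (d + 1) : ℝ) / (n : ℝ) ^ (d + 1) - 1 / ((d + 1).factorial : ℝ) =
      -((1 - n.descFactorial (d + 1) / (n : ℝ) ^ (d + 1)) / (d + 1).factorial) := by
    rw [hchoose]
    field_simp
    ring
  have h2 : (n.descFactorial (d + 1) : ℝ) / (n : ℝ) ^ (d + 1) ≤ 1 := by
    rwa [div_le_one hpow]
  have h3 : 1 - (d + 1) * d * (n : ℝ)⁻¹ ≤ n.descFactorial (d + 1) / (n : ℝ) ^ (d + 1) := by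
    rw [le_div_iff₀ hpow]
    linarith
  rw [h1, abs_neg, abs_of_nonneg (div_nonneg (by linarith) (by positivity))]
  refine (div_le_self (by linarith) hfac).trans ?_
  linarith

end Elementary

section Threshold

/-- The infinite values agree too: both sides fail at `⊥` and both hold at `⊤`. -/
lemma mul_sub_le_coe_iff {a M t : ℝ} (ha : 0 < a) (H : EReal) :
    (a : EReal) * ((M : EReal) - H) ≤ (t : EReal) ↔ ((M - t / a : ℝ) : EReal) ≤ H := by
  induction H with
  | bot =>
    rw [EReal.coe_sub_bot, EReal.coe_mul_top_of_pos ha]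
    simp only [top_le_iff, EReal.coe_ne_top, le_bot_iff, EReal.coe_ne_bot]
  | coe x =>
    rw [← EReal.coe_sub, ← EReal.coe_mul, EReal.coe_le_coe_iff, EReal.coe_le_coe_iff,
      sub_le_iff_le_add, ← sub_le_iff_le_add', le_div_iff₀ ha, mul_comm]
  | top =>
    rw [EReal.sub_top, EReal.coe_mul_bot_of_pos ha]
    simp

/-- The supremum is finite, hence attained when nonempty; if there are no tuples it is `⊥`, below
every real `c`. -/
lemma coe_le_uMax_iff {m n : ℕ} (f : (Fin m → Circle) → EReal) (x : ℕ → Circle) (c : ℝ) :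
    (c : EReal) ≤ uMax f n x ↔ ∃ J : Fin m ↪o Fin n, (c : EReal) ≤ f fun i => x (J i) := by
  classical
  rw [uMax, ← Finset.sup_univ_eq_iSup, Finset.le_sup_iff (EReal.bot_lt_coe c)]
  simp

variable {d : ℕ} {f : (Fin (d + 1) → Circle) → EReal} {h : (Fin d → ℝ) → EReal} {M : ℝ}
  {V : Finset (Fin d → ℝ)} {Ω : Type*} [MeasurableSpace Ω] {μ : Measure Ω}
  [IsProbabilityMeasure μ] {U : ℕ → Ω → Circle}

lemma KernelConditions.measureReal_mul_sub_uMax_le (hf : KernelConditions f h M V)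
    (hm : ∀ i, Measurable (U i)) {a t : ℝ} (ha : 0 < a) (n : ℕ) :
    μ.real {ω | (a : EReal) * ((M : EReal) - uMax f n fun i => U i ω) ≤ (t : EReal)} =
      1 - μ.real (⋂ J : Fin (d + 1) ↪o Fin n,
        (exceedance f ((M - t / a : ℝ) : EReal) U (indices J))ᶜ) := by
  have h1 : {ω | (a : EReal) * ((M : EReal) - uMax f n fun i => U i ω) ≤ (t : EReal)} =
      (⋂ J : Fin (d + 1) ↪o Fin n,
        (exceedance f ((M - t / a : ℝ) : EReal) U (indices J))ᶜ)ᶜ := by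
    ext ω
    rw [mem_ofPred_eq, mul_sub_le_coe_iff ha, coe_le_uMax_iff]
    simp only [compl_iInter, compl_compl, mem_iUnion]
    rfl
  rw [h1, probReal_compl_eq_one_sub]
  exact MeasurableSet.iInter fun J => (hf.measurableSet_exceedance hm _ _).compl

/-- The error in the Poisson approximation, for a threshold at distance `η ^ 2` from the maximum,
when `n * η = τ * x` with `x ^ d = 1 / n`. -/
lemma KernelConditions.abs_measure_no_exceedance_sub_exp_le_mul (hf : KernelConditions f h M V)
    (hd : 1 ≤ d) (hm : ∀ i, Measurable (U i)) (hind : iIndepFun U μ)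
    (hunif : ∀ i, μ.map (U i) = uniformCircle) {C τ : ℝ} (hC : 0 ≤ C) (hτ : 0 ≤ τ) :
    ∃ D : ℝ, ∀ (n : ℕ) (η x : ℝ), d + 1 ≤ n → 0 ≤ η → 0 ≤ x → x ≤ 1 →
      x ^ d = (n : ℝ)⁻¹ → (n : ℝ) * η = τ * x →
      superlevel h ((M - η ^ 2 : ℝ) : EReal) ⊆ ⋃ v ∈ V, Metric.ball v (C * η) →
      |exceedanceProb h ((M - η ^ 2 : ℝ) : EReal) - uniformConst h V * η ^ d| ≤
        C * η ^ (d + 1) →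
      |μ.real (⋂ J : Fin (d + 1) ↪o Fin n,
        (exceedance f ((M - η ^ 2 : ℝ) : EReal) U (indices J))ᶜ) -
        Real.exp (-(τ ^ d * uniformConst h V / ((d + 1).factorial : ℝ)))| ≤ D * x := by
  set K := uniformConst h V with hK
  have hK0 : 0 ≤ K := by
    have : 0 < Real.Gamma (((d : ℝ) + 2) / 2) := Real.Gamma_pos_of_pos (by positivity)
    rw [hK, uniformConst]
    positivity
  set P := K * τ ^ d + C * τ ^ (d + 1) with hP
  have hP0 : 0 ≤ P := by positivity
  -- The three lines bound, in order, the product terms, the joint terms and the error in the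
  -- Poisson mean; `P` bounds `n ^ (d+1)` times the exceedance probability.
  refine ⟨P * (P * (2 ^ (d + 1) * (d + 1))) +
    P * (V.card * (2 ^ (d + 1) * (d * (1 + C * τ) ^ d))) +
    (C * τ ^ (d + 1) + K * τ ^ d * ((d + 1) * d)), ?_⟩
  intro n η x hn hη hx0 hx1 hxd hnη hsub hprob
  have hn0 : (0 : ℝ) < n := by exact_mod_cast (by omega : 0 < n)
  have hn1 : (1 : ℝ) ≤ n := by exact_mod_cast (by omega : 1 ≤ n)
  set p := exceedanceProb h ((M - η ^ 2 : ℝ) : EReal) with hp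
  have hp0 : 0 ≤ p := measureReal_nonneg
  have hxpow : ∀ k, 1 ≤ k → x ^ k ≤ x := fun k hk =>
    (pow_le_pow_of_le_one hx0 hx1 hk).trans_eq (pow_one x)
  have hninv : (n : ℝ)⁻¹ ≤ x := hxd ▸ hxpow d hd
  have hηd : (n : ℝ) ^ (d + 1) * η ^ d = τ ^ d := by
    calc (n : ℝ) ^ (d + 1) * η ^ d = n * (n * η) ^ d := by ring
      _ = n * (τ ^ d * (n : ℝ)⁻¹) := by rw [hnη, mul_pow, hxd]
      _ = τ ^ d := by field_simp
  have hηd1 : (n : ℝ) ^ (d + 1) * η ^ (d + 1) ≤ τ ^ (d + 1) * x := by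
    rw [← mul_pow, hnη, mul_pow]
    gcongr
    exact hxpow _ (by omega)
  set c : ℝ := (n.choose (d + 1) : ℝ) with hc
  have hc0 : 0 ≤ c := Nat.cast_nonneg _
  have hcn : c ≤ (n : ℝ) ^ (d + 1) := by
    rw [hc]
    exact_mod_cast Nat.choose_le_pow n (d + 1)
  have hpP : (n : ℝ) ^ (d + 1) * p ≤ P := by
    have h1 : p ≤ K * η ^ d + C * η ^ (d + 1) := by linarith [(abs_le.1 hprob).2]
    have h2 : τ ^ (d + 1) * x ≤ τ ^ (d + 1) := mul_le_of_le_one_right (by positivity) hx1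
    calc (n : ℝ) ^ (d + 1) * p ≤ (n : ℝ) ^ (d + 1) * (K * η ^ d + C * η ^ (d + 1)) := by gcongr
      _ = K * ((n : ℝ) ^ (d + 1) * η ^ d) + C * ((n : ℝ) ^ (d + 1) * η ^ (d + 1)) := by ring
      _ ≤ P := by
        rw [hηd, hP]
        gcongr
        exact hηd1.trans h2
  have hcp : c * p ≤ P := (mul_le_mul_of_nonneg_right hcn hp0).trans hpP
  have hpn : p * (n : ℝ) ^ d ≤ P * x := by
    calc p * (n : ℝ) ^ d = (n : ℝ) ^ (d + 1) * p * (n : ℝ)⁻¹ := by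
          rw [pow_succ]
          field_simp
      _ ≤ P * x := by gcongr
  have hpois := hf.abs_measure_no_exceedance_sub_exp_le hm hind hunif
    (mul_nonneg hC hη) hsub n
  rw [← hc, ← hp] at hpois
  have hsum₁ : ∑ s ∈ Finset.range (d + 1), (n : ℝ) ^ s ≤ (d + 1) * (n : ℝ) ^ d := by
    refine (Finset.sum_le_card_nsmul _ _ ((n : ℝ) ^ d) fun s hs => ?_).trans_eq (by simp)
    exact pow_le_pow_right₀ hn1 (Nat.lt_succ_iff.1 (Finset.mem_range.1 hs))
  -- Each `n C η` equals `C τ x`, and `s ≥ 1` leaves at least one factor `x`.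
  have hsum₂ : ∑ s ∈ Finset.Icc 1 d, ((n : ℝ) * (C * η)) ^ s ≤ d * ((1 + C * τ) ^ d * x) := by
    refine (Finset.sum_le_card_nsmul _ _ ((1 + C * τ) ^ d * x) fun s hs => ?_).trans_eq (by simp)
    obtain ⟨hs1, hsd⟩ := Finset.mem_Icc.1 hs
    have h1 : (n : ℝ) * (C * η) = C * τ * x := by
      rw [mul_left_comm, hnη, mul_assoc]
    have h2 : 0 ≤ C * τ := by positivity
    rw [h1, mul_pow]
    have h3 : (C * τ) ^ s ≤ (1 + C * τ) ^ d :=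
      (pow_le_pow_left₀ h2 (by linarith) s).trans (pow_le_pow_right₀ (by linarith) hsd)
    have h4 := hxpow s hs1
    gcongr
  have hE₁ : c * (p ^ 2 * (2 ^ (d + 1) * ∑ s ∈ Finset.range (d + 1), (n : ℝ) ^ s)) ≤
      P * (P * (2 ^ (d + 1) * (d + 1))) * x := by
    calc c * (p ^ 2 * (2 ^ (d + 1) * ∑ s ∈ Finset.range (d + 1), (n : ℝ) ^ s))
        ≤ c * (p ^ 2 * (2 ^ (d + 1) * ((d + 1) * (n : ℝ) ^ d))) := by gcongr
      _ = (c * p) * ((p * (n : ℝ) ^ d) * (2 ^ (d + 1) * (d + 1))) := by ring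
      _ ≤ P * ((P * x) * (2 ^ (d + 1) * (d + 1))) := by gcongr
      _ = _ := by ring
  have hE₂ : c * (V.card * p * (2 ^ (d + 1) * ∑ s ∈ Finset.Icc 1 d, ((n : ℝ) * (C * η)) ^ s)) ≤
      P * (V.card * (2 ^ (d + 1) * (d * (1 + C * τ) ^ d))) * x := by
    calc c * (V.card * p * (2 ^ (d + 1) * ∑ s ∈ Finset.Icc 1 d, ((n : ℝ) * (C * η)) ^ s))
        ≤ c * (V.card * p * (2 ^ (d + 1) * (d * ((1 + C * τ) ^ d * x)))) := by gcongr
      _ = (c * p) * (V.card * (2 ^ (d + 1) * (d * (1 + C * τ) ^ d)) * x) := by ring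
      _ ≤ P * (V.card * (2 ^ (d + 1) * (d * (1 + C * τ) ^ d)) * x) := by gcongr
      _ = _ := by ring
  have hlam : |c * p - τ ^ d * K / ((d + 1).factorial : ℝ)| ≤
      (C * τ ^ (d + 1) + K * τ ^ d * ((d + 1) * d)) * x := by
    -- The mean differs from its limit through the exceedance probability and through `n.choose
    -- (d+1)` replacing `n ^ (d+1) / (d+1)!`.
    have h1 : c * p - τ ^ d * K / ((d + 1).factorial : ℝ) =
        c * (p - K * η ^ d) +
          K * τ ^ d * (c / (n : ℝ) ^ (d + 1) - 1 / ((d + 1).factorial : ℝ)) := by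
      rw [← hηd]
      field_simp
      ring
    have h2 : |c * (p - K * η ^ d)| ≤ C * τ ^ (d + 1) * x := by
      rw [abs_mul, abs_of_nonneg hc0]
      calc c * |p - K * η ^ d| ≤ (n : ℝ) ^ (d + 1) * (C * η ^ (d + 1)) := by gcongr
        _ = C * ((n : ℝ) ^ (d + 1) * η ^ (d + 1)) := by ring
        _ ≤ C * (τ ^ (d + 1) * x) := by gcongr
        _ = _ := by ring
    have h3 : |K * τ ^ d * (c / (n : ℝ) ^ (d + 1) - 1 / ((d + 1).factorial : ℝ))| ≤
        K * τ ^ d * ((d + 1) * d) * x := by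
      rw [abs_mul, abs_of_nonneg (by positivity : 0 ≤ K * τ ^ d), mul_assoc _ ((d + 1 : ℝ) * d)]
      have h4 := abs_choose_div_pow_sub_le hn
      gcongr
      refine h4.trans ?_
      gcongr
    rw [h1, add_mul]
    exact (abs_add_le _ _).trans (add_le_add h2 h3)
  have hexp := (abs_exp_neg_sub_exp_neg_le (mul_nonneg hc0 hp0)
    (by positivity : 0 ≤ τ ^ d * K / ((d + 1).factorial : ℝ))).trans hlam
  rw [mul_add] at hpois
  refine (abs_sub_le _ (Real.exp (-(c * p))) _).trans ?_
  rw [add_mul, add_mul]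
  linarith

end Threshold

end UMax

/-- The degree of the kernel is `m = d + 1 ≥ 2`; thus `2m/(m-1) = 2(d+1)/d`, `(m-1)/2 = d/2` and
`1/(m-1) = 1/d`. -/
theorem corollary4p2 {Ω : Type*} [MeasurableSpace Ω] (μ : Measure Ω) [IsProbabilityMeasure μ]
    (d : ℕ) (hd : 1 ≤ d)
    (f : (Fin (d + 1) → Circle) → EReal) (h : (Fin d → ℝ) → EReal)
    (M : ℝ) (V : Finset (Fin d → ℝ)) (hf : UMax.KernelConditions f h M V)
    (U : ℕ → Ω → Circle) (hU_meas : ∀ i, Measurable (U i)) (hU_indep : iIndepFun U μ)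
    (hU_unif : ∀ i, Measure.map (U i) μ = UMax.uniformCircle)
    (t : ℝ) (ht : 0 < t) :
    Tendsto (fun n : ℕ => μ.real {ω |
        (((n : ℝ) ^ (2 * ((d : ℝ) + 1) / (d : ℝ)) : ℝ) : EReal) *
          ((M : EReal) - UMax.uMax f n (fun i => U i ω)) ≤ (t : EReal)})
      atTop
      (𝓝 (1 - Real.exp (-(t ^ ((d : ℝ) / 2) * UMax.uniformConst h V / ((d + 1).factorial : ℝ))))) ∧
    (fun n : ℕ => μ.real {ω |
        (((n : ℝ) ^ (2 * ((d : ℝ) + 1) / (d : ℝ)) : ℝ) : EReal) *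
          ((M : EReal) - UMax.uMax f n (fun i => U i ω)) ≤ (t : EReal)} -
      (1 - Real.exp (-(t ^ ((d : ℝ) / 2) * UMax.uniformConst h V / ((d + 1).factorial : ℝ)))))
      =O[atTop] (fun n : ℕ => (n : ℝ) ^ (-(1 / (d : ℝ)))) := by
  have hd0 : (0 : ℝ) < d := by exact_mod_cast hd
  have hlim : Tendsto (fun n : ℕ => (n : ℝ) ^ (-(1 / (d : ℝ)))) atTop (𝓝 0) :=
    (tendsto_rpow_neg_atTop (by positivity)).comp tendsto_natCast_atTop_atTop
  -- The rate tends to zero, so it already implies the limit.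
  suffices hO : (fun n : ℕ => μ.real {ω |
        (((n : ℝ) ^ (2 * ((d : ℝ) + 1) / (d : ℝ)) : ℝ) : EReal) *
          ((M : EReal) - UMax.uMax f n (fun i => U i ω)) ≤ (t : EReal)} -
      (1 - Real.exp (-(t ^ ((d : ℝ) / 2) * UMax.uniformConst h V / ((d + 1).factorial : ℝ)))))
      =O[atTop] (fun n : ℕ => (n : ℝ) ^ (-(1 / (d : ℝ)))) from
    ⟨tendsto_sub_nhds_zero_iff.1 (hO.trans_tendsto hlim), hO⟩
  obtain ⟨C, hC0, hC⟩ := hf.exists_exceedanceProb_bound hd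
  obtain ⟨D, hD⟩ := hf.abs_measure_no_exceedance_sub_exp_le_mul hd hU_meas hU_indep hU_unif hC0
    (Real.sqrt_nonneg t)
  -- Chosen so that `η²` is the unscaled gap `t / n ^ (2(d+1)/d)`; then `n η = √t x` with `x = n ^
  -- (-1/d)`.
  set η : ℕ → ℝ := fun n => √t * (n : ℝ) ^ (-(((d : ℝ) + 1) / d)) with hη
  have hηlim : Tendsto η atTop (𝓝[>] 0) := by
    refine tendsto_nhdsWithin_iff.2 ⟨?_, ?_⟩
    · have h1 : Tendsto (fun n : ℕ => (n : ℝ) ^ (-(((d : ℝ) + 1) / d))) atTop (𝓝 0) :=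
        (tendsto_rpow_neg_atTop (by positivity)).comp tendsto_natCast_atTop_atTop
      simpa using h1.const_mul (√t)
    · filter_upwards [eventually_ge_atTop 1] with n hn
      have : (0 : ℝ) < n := by exact_mod_cast hn
      exact mul_pos (Real.sqrt_pos.2 ht) (Real.rpow_pos_of_pos this _)
  refine IsBigO.of_bound D ?_
  filter_upwards [hηlim.eventually hC, eventually_ge_atTop (d + 1)] with n hCn hn
  have hn0 : (0 : ℝ) < n := by exact_mod_cast (by omega : 0 < n)
  have hn1 : (1 : ℝ) ≤ n := by exact_mod_cast (by omega : 1 ≤ n)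
  have hη2 : t / (n : ℝ) ^ (2 * ((d : ℝ) + 1) / (d : ℝ)) = η n ^ 2 := by
    simp only [hη]
    rw [mul_pow, Real.sq_sqrt ht.le, ← Real.rpow_mul_natCast hn0.le, div_eq_mul_inv,
      ← Real.rpow_neg hn0.le]
    congr 2
    push_cast
    ring
  have hxd : ((n : ℝ) ^ (-(1 / (d : ℝ)))) ^ d = (n : ℝ)⁻¹ := by
    rw [← Real.rpow_mul_natCast hn0.le, neg_mul, one_div, inv_mul_cancel₀ hd0.ne',
      Real.rpow_neg_one]
  have hnη : (n : ℝ) * η n = √t * (n : ℝ) ^ (-(1 / (d : ℝ))) := by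
    simp only [hη]
    rw [mul_left_comm]
    congr 1
    nth_rewrite 1 [← Real.rpow_one (n : ℝ)]
    rw [← Real.rpow_add hn0]
    congr 1
    field_simp
    ring
  have hηn0 : 0 ≤ η n := by
    simp only [hη]
    positivity
  have hτ : t ^ ((d : ℝ) / 2) = √t ^ d := by
    rw [div_eq_inv_mul, Real.rpow_mul ht.le, Real.rpow_natCast, Real.sqrt_eq_rpow, one_div]
  rw [hf.measureReal_mul_sub_uMax_le hU_meas (Real.rpow_pos_of_pos hn0 _), hη2, hτ,
    sub_sub_sub_cancel_left, norm_sub_rev, Real.norm_eq_abs, Real.norm_eq_abs,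
    abs_of_nonneg (Real.rpow_nonneg hn0.le (-(1 / (d : ℝ))))]
  exact hD n (η n) _ hn hηn0 (Real.rpow_nonneg hn0.le _)
    (Real.rpow_le_one_of_one_le_of_nonpos hn1 (by simp)) hxd hnη hCn.1 hCn.2
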